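/- \textbf{Notation.} Let $d \geq 2$ be an integer and $p > 1$ a real number. For $A \subset \mathbb{R}^d$ and $x, y \in \mathbb{R}^d$ let $L(x,y;A)$ denote the power-weighted shortest path length from $x$ to $y$ through $A \cup \{x,y\}$, i.e. the infimum of $\sum_{i=1}^{k} |v_i - v_{i-1}|^p$ over all finite paths $x = v_0, v_1, \dots, v_k = y$ with all $v_i \in A \cup \{x,y\}$. Write $B(z;R)$ for the open Euclidean ball of radius $R$ centered at $z$. A homogeneous Poisson point process of intensity $\lambda$ is a random set $\mathcal{H}_\lambda \subset \mathbb{R}^d$ such that, for every Borel set $B$ of finite Lebesgue measure $|B|$, the number of points of $\mathcal{H}_\lambda$ in $B$ is Poisson with mean $\lambda |B|$ and, conditionally on this number, these points are i.i.d. uniform over $B$. \textbf{Proposition.} For every $d \ge 2$ and $p > 1$ there is a constant $C(d,p) > 0$, depending only on $d$ and $p$, which is the shortest path constant of the homogeneous Poisson point process $\mathcal{H}_1$ of unit intensity, i.e. for every unit vector $e \in \mathbb{R}^d$ $$\lim_{t\to\infty} \frac{1}{t}\, \mathbb{E}\, L(0, te; \mathcal{H}_1) = C(d,p),$$ and for which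 the following holds. Let $z \in \mathbb{R}^d$, $R_2 > R_1 > 0$, and $\alpha = (d+2p)^{-1}$. Let $X_1, X_2, \dots$ be i.i.d. with the uniform probability density $f$ on $B(z;R_2)$ (so $f = 1/|B(z;R_2)|$ on $B(z;R_2)$ and $f = 0$ elsewhere), and write $L_n(x,y) = L(x,y;\{X_1,\dots,X_n\})$. Let $x_n, y_n$ be (non-random) sequences in $B(z;R_1)$ satisfying $\lim_{n\to\infty} (n f(z))^{\alpha} |x_n - y_n| = +\infty$. Then $$\lim_{n\to\infty} \frac{\mathbb{E}\, L_n(x_n,y_n)}{(n f(z))^{(1-p)/d}\, |x_n-y_n|} = C(d,p).$$ (All the random variables whose expectations appear above are integrable.) -/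

import Mathlib

open MeasureTheory ProbabilityTheory Filter Topology
open scoped NNReal ENNReal

noncomputable section

/-- The power-weighted length `∑ |edge| ^ p` of the path `x → l₁ → ⋯ → lₖ → y` whose interior nodes,
in order, are the entries of the list `l`. -/
def pathLength {E : Type*} [MetricSpace E] (p : ℝ) : E → List E → E → ℝ
  | x, [], y => dist x y ^ p
  | x, v :: l, y => dist x v ^ p + pathLength p v l y

/-- `L(x, y; A)`: the power-weighted shortest path length from `x` to `y` through `A ∪ {x, y}`. -/
def shortestPath {E : Type*} [MetricSpace E] (p : ℝ) (A : Set E) (x y : E) : ℝ :=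
  ⨅ l : {l : List E // ∀ v ∈ l, v ∈ A ∪ {x, y}}, pathLength p x l.1 y

/-- The density of the uniform distribution on the open ball `B(z; R)`. -/
def uniformDensity {d : ℕ} (z : EuclideanSpace ℝ (Fin d)) (R : ℝ) :
    EuclideanSpace ℝ (Fin d) → ℝ :=
  (Metric.ball z R).indicator fun _ => (volume.real (Metric.ball z R))⁻¹

/-- Point configurations in `E`: sets of points, with the σ-algebra generated by the counts
`A ↦ #(A ∩ B)` for Borel sets `B`. -/
structure PointSet (E : Type*) where
  points : Set E

instance PointSet.instMeasurableSpace (E : Type*) [MeasurableSpace E] :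
    MeasurableSpace (PointSet E) :=
  ⨆ B : {B : Set E // MeasurableSet B},
    MeasurableSpace.comap (fun A : PointSet E => (A.points ∩ B.1).encard) ⊤

/-- The law of `{U₁, …, U_N}` for `N` Poisson with mean `lam * |B|` and, conditionally on `N`,
`U₁, …, U_N` independent and uniformly distributed over `B`. -/
def poissonLaw {d : ℕ} (lam : ℝ≥0) (B : Set (EuclideanSpace ℝ (Fin d))) :
    Measure (PointSet (EuclideanSpace ℝ (Fin d))) :=
  (poissonMeasure (lam * (volume B).toNNReal)).bind fun n =>
    (Measure.pi fun _ : Fin n => cond volume B).map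
      fun u => PointSet.mk (Set.range u)

/-- `H` is a homogeneous Poisson point process in `ℝᵈ` of intensity `lam`: for every Borel set `B` of
finite Lebesgue measure, the number of points of `H` in `B` is Poisson with mean `lam * |B|` and,
conditionally on this number, the points of `H` in `B` are i.i.d. uniform over `B`. -/
def IsPoissonProcess {d : ℕ} {Ω : Type*} [MeasurableSpace Ω] (lam : ℝ≥0)
    (H : Ω → Set (EuclideanSpace ℝ (Fin d))) (P : Measure Ω) : Prop :=
  ∀ B : Set (EuclideanSpace ℝ (Fin d)), MeasurableSet B → volume B ≠ ∞ →
    HasLaw (fun ω => PointSet.mk (H ω ∩ B)) (poissonLaw lam B) P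

end

/-! ### Deterministic properties of power-weighted paths. -/

section Paths

variable {E : Type*} [MetricSpace E] {p : ℝ}

/-! Let `g t` be the mean path length over a distance `t` through the unit-intensity process in the
whole space (`radialMean`, the limit of the means in growing balls). Cut a segment of length `t`
into pieces of length `s`. Good paths along the pieces do not meet at points of the process, so each
division point is replaced by a nearby point of the process. By convexity of `r ^ p` this costs a
factor `T > 1`, as close to 1 as desired, and an additive error of bounded mean, because a large
ball is empty with exponentially small probability. Hence `g t ≤ T * (t / s * g s + s ^ p) + K * (t
/ s + 1)` with `K` depending on `T` (`exists_meanPath_le_steps`), and `g t / t` converges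
(`exists_tendsto_div_of_approx_subadditive`). The limit is the constant.

The same upper bound holds in a ball if the segment stays far from the boundary, while restricting
the points to a domain can only lengthen paths. After dilation to unit intensity this gives the
limit for Poisson points in a ball (`tendsto_meanPath_dilation`). A sample of `n` points is compared
with Poisson samples of mean size `κ * n`, `κ` near 1: more points shorten paths, and a Chernoff
bound handles counts on the wrong side of `n` (`tendsto_sampleMean_div`). The growth condition on
the ends enters through its consequence `(n f(z)) ^ (1 / d) * |x_n - y_n| → ∞`, valid since `1 / (d
+ 2 p) ≤ 1 / d`.

The constant is positive because an exponential moment of minus the path length is at most a sum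
over all paths through independent points, which is a convergent geometric series times a factor
decaying exponentially in the distance of the ends (`exists_le_sampleMean`).

Laws of configurations enter only through void probabilities: the path length is measurable for the
σ-algebra of the void events, so restriction, dilation and rotation invariance all follow from
`poissonLaw_voidEvent`. -/

theorem pathLength_nonneg (p : ℝ) (x : E) (l : List E) (y : E) : 0 ≤ pathLength p x l y := by
  induction l generalizing x with
  | nil => exact Real.rpow_nonneg dist_nonneg _
  | cons v l ih => exact add_nonneg (Real.rpow_nonneg dist_nonneg _) (ih v)

theorem pathLength_append (p : ℝ) (x : E) (l₁ : List E) (v : E) (l₂ : List E) (y : E) :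
    pathLength p x (l₁ ++ v :: l₂) y = pathLength p x l₁ v + pathLength p v l₂ y := by
  induction l₁ generalizing x with
  | nil => rfl
  | cons w l ih => simp [pathLength, ih, add_assoc]

theorem pathLength_reverse (p : ℝ) (x : E) (l : List E) (y : E) :
    pathLength p y l.reverse x = pathLength p x l y := by
  induction l generalizing x with
  | nil => simp [pathLength, dist_comm]
  | cons v l ih => simp [pathLength, pathLength_append, ih, dist_comm x v, add_comm]

theorem shortestPath_bddBelow (p : ℝ) (A : Set E) (x y : E) :
    BddBelow (Set.range fun l : {l : List E // ∀ v ∈ l, v ∈ A ∪ {x, y}} =>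
      pathLength p x l.1 y) :=
  ⟨0, by rintro _ ⟨l, rfl⟩; exact pathLength_nonneg _ _ _ _⟩

instance pathSubtype_nonempty (A : Set E) (x y : E) :
    Nonempty {l : List E // ∀ v ∈ l, v ∈ A ∪ {x, y}} := ⟨⟨[], by simp⟩⟩

theorem shortestPath_nonneg (p : ℝ) (A : Set E) (x y : E) : 0 ≤ shortestPath p A x y :=
  le_ciInf fun _ => pathLength_nonneg _ _ _ _

theorem shortestPath_le_pathLength {A : Set E} {x y : E} {l : List E}
    (h : ∀ v ∈ l, v ∈ A ∪ {x, y}) : shortestPath p A x y ≤ pathLength p x l y :=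
  ciInf_le (shortestPath_bddBelow p A x y) ⟨l, h⟩

theorem shortestPath_le_dist (p : ℝ) (A : Set E) (x y : E) :
    shortestPath p A x y ≤ dist x y ^ p :=
  shortestPath_le_pathLength (l := []) (by simp)

/-- Every path can be shortened to one without repetitions whose interior nodes avoid the ends. -/
theorem exists_nodup_path (p : ℝ) {A : Set E} {x y : E} (l : List E)
    (h : ∀ v ∈ l, v ∈ A ∪ {x, y}) :
    ∃ l' : List E, l'.Nodup ∧ (∀ v ∈ l', v ∈ A) ∧
      pathLength p x l' y ≤ pathLength p x l y := by
  induction hn : l.length using Nat.strong_induction_on generalizing l with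
  | _ n ih =>
    by_cases hx : x ∈ l
    · obtain ⟨l₁, l₂, rfl⟩ := List.append_of_mem hx
      obtain ⟨l', h1, h2, h3⟩ := ih l₂.length (by simp [← hn]; omega) l₂
        (fun v hv => h v (by simp [hv])) rfl
      refine ⟨l', h1, h2, h3.trans ?_⟩
      rw [pathLength_append]
      linarith [pathLength_nonneg p x l₁ x]
    by_cases hy : y ∈ l
    · obtain ⟨l₁, l₂, rfl⟩ := List.append_of_mem hy
      obtain ⟨l', h1, h2, h3⟩ := ih l₁.length (by simp [← hn]) l₁
        (fun v hv => h v (by simp [hv])) rfl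
      refine ⟨l', h1, h2, h3.trans ?_⟩
      rw [pathLength_append]
      linarith [pathLength_nonneg p y l₂ y]
    by_cases hd : l.Nodup
    · refine ⟨l, hd, fun v hv => ?_, le_rfl⟩
      rcases h v hv with h | h | h
      · exact h
      · exact absurd (h ▸ hv) hx
      · exact absurd (Set.mem_singleton_iff.1 h ▸ hv) hy
    · obtain ⟨v, hv⟩ := List.exists_duplicate_iff_not_nodup.2 hd
      rw [List.duplicate_iff_sublist] at hv
      obtain ⟨l₁, l₂, rfl, h1, h2⟩ := List.append_sublist_iff (l₁ := [v]) (l₂ := [v]) |>.1 hv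
      obtain ⟨a, b, rfl⟩ := List.append_of_mem (List.singleton_sublist.1 h1)
      obtain ⟨c, e, rfl⟩ := List.append_of_mem (List.singleton_sublist.1 h2)
      obtain ⟨l', h1, h2, h3⟩ := ih (a ++ v :: e).length (by simp [← hn]; omega) (a ++ v :: e)
        (fun w hw => h w (by simp at hw ⊢; tauto)) rfl
      refine ⟨l', h1, h2, h3.trans ?_⟩
      have : (a ++ v :: b) ++ (c ++ v :: e) = a ++ v :: ((b ++ c) ++ v :: e) := by simp
      rw [this, pathLength_append, pathLength_append, pathLength_append]
      linarith [pathLength_nonneg p v (b ++ c) v]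

theorem exists_path_of_shortestPath_lt {A : Set E} {x y : E} {c : ℝ}
    (h : shortestPath p A x y < c) :
    ∃ l : List E, l.Nodup ∧ (∀ v ∈ l, v ∈ A) ∧ pathLength p x l y < c := by
  obtain ⟨⟨l, hl⟩, hc⟩ := exists_lt_of_ciInf_lt h
  obtain ⟨l', h1, h2, h3⟩ := exists_nodup_path p l hl
  exact ⟨l', h1, h2, h3.trans_lt hc⟩

theorem le_shortestPath {A : Set E} {x y : E} {c : ℝ}
    (h : ∀ l : List E, l.Nodup → (∀ v ∈ l, v ∈ A) → c ≤ pathLength p x l y) :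
    c ≤ shortestPath p A x y := by
  by_contra! hc
  obtain ⟨l, h1, h2, h3⟩ := exists_path_of_shortestPath_lt hc
  exact absurd (h l h1 h2) (not_le.2 h3)

theorem shortestPath_lt_iff {A : Set E} {x y : E} {c : ℝ} :
    shortestPath p A x y < c ↔ ∃ l : List E, (∀ v ∈ l, v ∈ A) ∧ pathLength p x l y < c := by
  constructor
  · intro h
    obtain ⟨l, -, h2, h3⟩ := exists_path_of_shortestPath_lt h
    exact ⟨l, h2, h3⟩
  · rintro ⟨l, h1, h2⟩
    exact (shortestPath_le_pathLength fun v hv => Or.inl (h1 v hv)).trans_lt h2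

theorem shortestPath_anti {A A' : Set E} (h : A ⊆ A') (x y : E) :
    shortestPath p A' x y ≤ shortestPath p A x y :=
  le_shortestPath fun _ _ hl => shortestPath_le_pathLength fun v hv => Or.inl (h (hl v hv))

theorem shortestPath_comm (A : Set E) (x y : E) :
    shortestPath p A x y = shortestPath p A y x := by
  have key : ∀ x y : E, shortestPath p A x y ≤ shortestPath p A y x := fun x y =>
    le_shortestPath fun l _ hl => by
      rw [← pathLength_reverse]
      exact shortestPath_le_pathLength fun v hv => Or.inl (hl v (by simpa using hv))
  exact le_antisymm (key x y) (key y x)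

/-- The meeting point must lie in `A` for the concatenation to be admissible; paths meeting
elsewhere first need their ends moved. -/
theorem shortestPath_triangle {A : Set E} {q : E} (hq : q ∈ A) (x y : E) :
    shortestPath p A x y ≤ shortestPath p A x q + shortestPath p A q y := by
  rw [← sub_le_iff_le_add']
  refine le_shortestPath fun l₂ _ h₂ => ?_
  rw [sub_le_iff_le_add, ← sub_le_iff_le_add']
  refine le_shortestPath fun l₁ _ h₁ => ?_
  rw [sub_le_iff_le_add', add_comm, ← pathLength_append]
  refine shortestPath_le_pathLength fun v hv => Or.inl ?_
  simp only [List.mem_append, List.mem_cons] at hv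
  rcases hv with h | rfl | h
  exacts [h₁ v h, hq, h₂ v h]

theorem pathLength_map {F : Type*} [MetricSpace F] {S : E → F} {r : ℝ} (hr : 0 ≤ r)
    (hS : ∀ x y, dist (S x) (S y) = r * dist x y) (x : E) (l : List E) (y : E) :
    pathLength p (S x) (l.map S) (S y) = r ^ p * pathLength p x l y := by
  induction l generalizing x with
  | nil => simp [pathLength, hS, Real.mul_rpow hr dist_nonneg]
  | cons v l ih => simp [pathLength, hS, Real.mul_rpow hr dist_nonneg, ih, mul_add]

theorem shortestPath_image {F : Type*} [MetricSpace F] {S : E → F} {r : ℝ}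
    (hr : 0 < r) (hS : ∀ x y, dist (S x) (S y) = r * dist x y) (A : Set E) (x y : E) :
    shortestPath p (S '' A) (S x) (S y) = r ^ p * shortestPath p A x y := by
  have hr' : 0 < r ^ p := Real.rpow_pos_of_pos hr p
  apply le_antisymm
  · rw [← div_le_iff₀' hr']
    refine le_shortestPath fun l _ hl => ?_
    rw [div_le_iff₀' hr', ← pathLength_map hr.le hS]
    refine shortestPath_le_pathLength fun v hv => Or.inl ?_
    obtain ⟨w, hw, rfl⟩ := List.mem_map.1 hv
    exact ⟨w, hl w hw, rfl⟩
  · refine le_shortestPath fun l _ hl => ?_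
    obtain ⟨l', rfl⟩ : l ∈ Set.range (List.map S) := by
      rw [Set.range_list_map]
      intro v hv
      obtain ⟨w, -, rfl⟩ := hl v hv
      exact ⟨w, rfl⟩
    rw [pathLength_map hr.le hS]
    refine mul_le_mul_of_nonneg_left (shortestPath_le_pathLength fun v hv => Or.inl ?_) hr'.le
    obtain ⟨w, hw, h⟩ := hl (S v) (List.mem_map_of_mem hv)
    have : dist w v = 0 := by
      have := hS w v
      rw [h, dist_self] at this
      rcases mul_eq_zero.1 this.symm with h | h
      · exact absurd h hr.ne'
      · exact h
    rwa [← dist_eq_zero.1 this]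

/-- Convexity of `r ^ p` at `a + b = τ * (a / τ) + (1 - τ) * (b / (1 - τ))`. For `τ` near 1 the
first coefficient is near 1, so stretching an edge costs little more than an additive error. -/
theorem add_rpow_le_of_lt_one (hp : 1 ≤ p) {a b τ : ℝ} (ha : 0 ≤ a) (hb : 0 ≤ b)
    (h0 : 0 < τ) (h1 : τ < 1) :
    (a + b) ^ p ≤ τ ^ (1 - p) * a ^ p + (1 - τ) ^ (1 - p) * b ^ p := by
  have h1' : 0 < 1 - τ := sub_pos.2 h1
  have := (convexOn_rpow hp).2 (x := a / τ) (y := b / (1 - τ)) (Set.mem_Ici.2 (by positivity))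
    (Set.mem_Ici.2 (by positivity)) h0.le h1'.le (by ring)
  simp only [smul_eq_mul] at this
  rw [mul_div_cancel₀ _ h0.ne', mul_div_cancel₀ _ h1'.ne', Real.div_rpow ha h0.le,
    Real.div_rpow hb h1'.le] at this
  refine this.trans_eq ?_
  rw [Real.rpow_sub h0, Real.rpow_sub h1', Real.rpow_one, Real.rpow_one]
  ring

/-- Moving one end of a path. -/
theorem shortestPath_move_left (hp : 1 < p) {τ : ℝ} (h0 : 0 < τ) (h1 : τ < 1) (A : Set E)
    (q x y : E) :
    shortestPath p A q y ≤
      τ ^ (1 - p) * shortestPath p A x y + (1 - τ) ^ (1 - p) * dist x q ^ p := by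
  have hτ : 0 < τ ^ (1 - p) := Real.rpow_pos_of_pos h0 _
  have hτ1 : 1 ≤ τ ^ (1 - p) := Real.one_le_rpow_of_pos_of_le_one_of_nonpos h0 h1.le (by linarith)
  have edge : ∀ v, dist q v ^ p ≤
      τ ^ (1 - p) * dist x v ^ p + (1 - τ) ^ (1 - p) * dist x q ^ p := fun v => by
    refine le_trans (Real.rpow_le_rpow dist_nonneg ?_ (by linarith))
      (add_rpow_le_of_lt_one hp.le dist_nonneg dist_nonneg h0 h1)
    linarith [dist_triangle_left q v x]
  rw [← sub_le_iff_le_add, ← div_le_iff₀' hτ]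
  refine le_shortestPath fun l _ hl => ?_
  rw [div_le_iff₀' hτ, sub_le_iff_le_add]
  refine (shortestPath_le_pathLength (l := l) fun v hv => Or.inl (hl v hv)).trans ?_
  cases l with
  | nil => exact edge y
  | cons v l =>
    -- Only the first edge changes; the others may carry the same factor because it is at least 1.
    simp only [pathLength]
    nlinarith [edge v, pathLength_nonneg p v l y]

theorem shortestPath_move (hp : 1 < p) {τ : ℝ} (h0 : 0 < τ) (h1 : τ < 1) (A : Set E)
    (q q' x y : E) :
    shortestPath p A q q' ≤ (τ ^ (1 - p)) ^ 2 * shortestPath p A x y +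
      τ ^ (1 - p) * (1 - τ) ^ (1 - p) * (dist x q ^ p + dist y q' ^ p) := by
  have hτ1 : 1 ≤ τ ^ (1 - p) := Real.one_le_rpow_of_pos_of_le_one_of_nonpos h0 h1.le (by linarith)
  have hτ2 : 0 < (1 - τ) ^ (1 - p) := Real.rpow_pos_of_pos (by linarith) _
  have h2 := shortestPath_move_left hp h0 h1 A q' y q
  have h3 := shortestPath_move_left hp h0 h1 A q x y
  rw [shortestPath_comm, shortestPath_comm A y q] at h2
  have h4 : 0 ≤ dist y q' ^ p := Real.rpow_nonneg dist_nonneg _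
  nlinarith [mul_le_mul_of_nonneg_left h3 (by linarith : 0 ≤ τ ^ (1 - p)),
    mul_le_mul_of_nonneg_right hτ1 (mul_nonneg hτ2.le h4)]

/-- Concatenation of paths whose ends are moved to nearby points of `A`. -/
theorem shortestPath_chain (hp : 1 < p) {τ : ℝ} (h0 : 0 < τ) (h1 : τ < 1) {A : Set E}
    (x q : ℕ → E) (m : ℕ) (hq : ∀ i, 0 < i → i < m → q i ∈ A) :
    shortestPath p A (q 0) (q m) ≤ ∑ i ∈ Finset.range m,
      ((τ ^ (1 - p)) ^ 2 * shortestPath p A (x i) (x (i + 1)) +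
        τ ^ (1 - p) * (1 - τ) ^ (1 - p) *
          (dist (x i) (q i) ^ p + dist (x (i + 1)) (q (i + 1)) ^ p)) := by
  induction m with
  | zero =>
    simpa [Real.zero_rpow (by linarith : p ≠ 0)] using shortestPath_le_dist p A (q 0) (q 0)
  | succ m ih =>
    rw [Finset.sum_range_succ]
    have hm := shortestPath_move hp h0 h1 A (q m) (q (m + 1)) (x m) (x (m + 1))
    rcases Nat.eq_zero_or_pos m with rfl | hpos
    · simpa using hm
    · have := shortestPath_triangle (p := p) (hq m hpos (by omega)) (q 0) (q (m + 1))
      have := ih fun i hi hi' => hq i hi (by omega)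
      linarith

end Paths

/-! ### Void events and measurability of the path length. -/

section Void

variable {E : Type*} {p : ℝ}

/-- The configurations without points in `U`. -/
def voidEvent (U : Set E) : Set (PointSet E) := {A | A.points ∩ U = ∅}

/-- The σ-algebra generated by the events that an open set contains no points. -/
@[reducible] def voidSigma (E : Type*) [TopologicalSpace E] : MeasurableSpace (PointSet E) :=
  MeasurableSpace.generateFrom {s | ∃ U : Set E, IsOpen U ∧ s = voidEvent U}

theorem PointSet.measurable_encard [MeasurableSpace E] {B : Set E} (hB : MeasurableSet B) :
    Measurable[_, ⊤] fun A : PointSet E => (A.points ∩ B).encard := by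
  rw [measurable_iff_comap_le]
  exact le_iSup (fun B : {B : Set E // MeasurableSet B} =>
    MeasurableSpace.comap (fun A : PointSet E => (A.points ∩ B.1).encard) ⊤) ⟨B, hB⟩

theorem PointSet.measurable_iff [MeasurableSpace E] {Ω : Type*} [MeasurableSpace Ω]
    {f : Ω → PointSet E} : Measurable f ↔ ∀ B : Set E, MeasurableSet B →
      Measurable[_, ⊤] fun ω => ((f ω).points ∩ B).encard := by
  constructor
  · intro h B hB
    exact fun s hs => h (PointSet.measurable_encard hB hs)
  · intro h
    rw [measurable_iff_comap_le, PointSet.instMeasurableSpace, MeasurableSpace.comap_iSup]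
    refine iSup_le fun B => ?_
    rw [MeasurableSpace.comap_comp, ← measurable_iff_comap_le]
    exact h B.1 B.2

theorem measurableSet_voidEvent [MeasurableSpace E] {U : Set E} (hU : MeasurableSet U) :
    MeasurableSet (voidEvent U) := by
  have : voidEvent U = (fun A : PointSet E => (A.points ∩ U).encard) ⁻¹' {0} := by
    ext A; simp [voidEvent]
  rw [this]
  exact PointSet.measurable_encard hU trivial

theorem voidSigma_le [TopologicalSpace E] [MeasurableSpace E] [OpensMeasurableSpace E] :
    voidSigma E ≤ PointSet.instMeasurableSpace E := by
  refine MeasurableSpace.generateFrom_le ?_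
  rintro _ ⟨U, hU, rfl⟩
  exact measurableSet_voidEvent hU.measurableSet

/-- Missing `U` and missing `V` is missing `U ∪ V`; hence void probabilities determine a probability
law on `voidSigma`. -/
theorem isPiSystem_voidEvent [TopologicalSpace E] :
    IsPiSystem {s | ∃ U : Set E, IsOpen U ∧ s = voidEvent U} := by
  rintro _ ⟨U, hU, rfl⟩ _ ⟨V, hV, rfl⟩ -
  refine ⟨U ∪ V, hU.union hV, ?_⟩
  ext A
  simp [voidEvent, Set.inter_union_distrib_left]

/-- Integrals of functions of the void events are determined by the void probabilities. -/
theorem integral_eq_of_voidEvent [TopologicalSpace E] [MeasurableSpace E] [OpensMeasurableSpace E]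
    {μ ν : Measure (PointSet E)} [IsProbabilityMeasure μ] [IsProbabilityMeasure ν]
    (h : ∀ U : Set E, IsOpen U → μ (voidEvent U) = ν (voidEvent U))
    {F : PointSet E → ℝ} (hF : Measurable[voidSigma E] F) : ∫ A, F A ∂μ = ∫ A, F A ∂ν := by
  have key : μ.trim voidSigma_le = ν.trim voidSigma_le := by
    have := isFiniteMeasure_trim (μ := μ) (voidSigma_le (E := E))
    refine ext_of_generate_finite _ rfl isPiSystem_voidEvent ?_ ?_
    · rintro _ ⟨U, hU, rfl⟩
      have : MeasurableSet[voidSigma E] (voidEvent U) :=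
        MeasurableSpace.measurableSet_generateFrom ⟨U, hU, rfl⟩
      rw [trim_measurableSet_eq _ this, trim_measurableSet_eq _ this, h U hU]
    · rw [trim_measurableSet_eq _ MeasurableSet.univ, trim_measurableSet_eq _ MeasurableSet.univ]
      simp
  have hF' : StronglyMeasurable[voidSigma E] F := hF.stronglyMeasurable
  rw [integral_trim voidSigma_le hF', integral_trim voidSigma_le hF', key]

/-- Small perturbations of the nodes of a path keep its length below a given bound. -/
theorem exists_basis_pathLength_lt [MetricSpace E] [SecondCountableTopology E] (hp : 0 < p)
    (y : E) (l : List E) : ∀ (x : E) (c : ℝ), pathLength p x l y < c →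
    ∃ V ∈ TopologicalSpace.countableBasis E, x ∈ V ∧ ∃ Us : List (Set E),
      (∀ U ∈ Us, U ∈ TopologicalSpace.countableBasis E) ∧ List.Forall₂ (· ∈ ·) l Us ∧
      ∀ x' ∈ V, ∀ l', List.Forall₂ (· ∈ ·) l' Us → pathLength p x' l' y < c := by
  have hb := TopologicalSpace.isBasis_countableBasis E
  induction l with
  | nil =>
    intro x c h
    have hc : Continuous fun x : E => dist x y ^ p :=
      (continuous_id.dist continuous_const).rpow_const fun _ => Or.inr hp.le
    obtain ⟨V, hV, hxV, hVs⟩ := hb.exists_subset_of_mem_open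
      (show x ∈ {x : E | dist x y ^ p < c} from h) (isOpen_lt hc continuous_const)
    refine ⟨V, hV, hxV, [], by simp, by simp, fun x' hx' l' hl' => ?_⟩
    rw [List.forall₂_nil_right_iff.1 hl']
    exact hVs hx'
  | cons v l ih =>
    intro x c h
    simp only [pathLength] at h
    obtain ⟨c', h1, h2⟩ := exists_between (lt_sub_iff_add_lt'.2 h)
    obtain ⟨W, hW, hvW, Us, hUs, hl, hWs⟩ := ih v c' h1
    have hc : Continuous fun z : E × E => dist z.1 z.2 ^ p :=
      continuous_dist.rpow_const fun _ => Or.inr hp.le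
    have hopen : IsOpen {z : E × E | dist z.1 z.2 ^ p < c - c'} := isOpen_lt hc continuous_const
    obtain ⟨V₀, W₀, hV₀, hW₀, hx, hv, hVW⟩ := isOpen_prod_iff.1 hopen x v (by
      simp only [Set.mem_ofPred_eq]; linarith)
    obtain ⟨V, hV, hxV, hVs⟩ := hb.exists_subset_of_mem_open hx hV₀
    obtain ⟨W₁, hW₁, hvW₁, hW₁s⟩ := hb.exists_subset_of_mem_open
      (show v ∈ W₀ ∩ W from ⟨hv, hvW⟩) (hW₀.inter (hb.isOpen hW))
    refine ⟨V, hV, hxV, W₁ :: Us, ?_, by simp [hvW₁, hl], ?_⟩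
    · simp only [List.mem_cons, forall_eq_or_imp]
      exact ⟨hW₁, hUs⟩
    · intro x' hx' l' hl'
      obtain ⟨v', l'', hv', hl'', rfl⟩ := List.forall₂_cons_right_iff.1 hl'
      have h3 : dist x' v' ^ p < c - c' :=
        hVW (Set.mk_mem_prod (hVs hx') (hW₁s hv').1)
      have h4 := hWs v' (hW₁s hv').2 l'' hl''
      simp only [pathLength]
      linarith

/-- A length below `c` is an open condition on the nodes. So `L < c` means that the configuration
meets every set of some finite list of basic open sets, any selection from which has length below
`c`; there are countably many such lists. -/
theorem measurable_shortestPath_voidSigma [MetricSpace E] [SecondCountableTopology E]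
    (hp : 0 < p) (x y : E) :
    Measurable[voidSigma E] fun A : PointSet E => shortestPath p A.points x y := by
  let _ : MeasurableSpace (PointSet E) := voidSigma E
  refine measurable_of_Iio fun c => ?_
  let S : Set (List (Set E)) := {Us | (∀ U ∈ Us, U ∈ TopologicalSpace.countableBasis E) ∧
    ∀ l, List.Forall₂ (· ∈ ·) l Us → pathLength p x l y < c}
  have hS : S.Countable := by
    have h1 : {Us : List (Set E) | ∀ U ∈ Us, U ∈ TopologicalSpace.countableBasis E}.Countable := by
      have := (TopologicalSpace.countable_countableBasis E).to_subtype
      have := Set.countable_range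
        (List.map (Subtype.val : TopologicalSpace.countableBasis E → Set E))
      rwa [Set.range_list_map_coe] at this
    exact h1.mono fun Us h => h.1
  have : (fun A : PointSet E => shortestPath p A.points x y) ⁻¹' Set.Iio c =
      ⋃ Us ∈ S, ⋂ U ∈ {U | U ∈ Us}, (voidEvent U)ᶜ := by
    ext A
    simp only [Set.mem_preimage, Set.mem_Iio, Set.mem_iUnion, Set.mem_iInter, Set.mem_compl_iff,
      shortestPath_lt_iff, exists_prop, Set.mem_ofPred_eq]
    constructor
    · rintro ⟨l, hl, hlc⟩
      obtain ⟨V, -, hxV, Us, hUs, hlU, h⟩ := exists_basis_pathLength_lt hp y l x c hlc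
      refine ⟨Us, ⟨hUs, h x hxV⟩, fun U hU => ?_⟩
      clear hUs h hlc
      induction hlU with
      | nil => simp at hU
      | @cons v W l Us hv _ ih =>
        rcases List.mem_cons.1 hU with rfl | hU
        · exact Set.Nonempty.ne_empty ⟨v, hl v (by simp), hv⟩
        · exact ih (fun w hw => hl w (by simp [hw])) hU
    · rintro ⟨Us, ⟨-, h2⟩, h3⟩
      have : ∃ l : List E, (∀ v ∈ l, v ∈ A.points) ∧ List.Forall₂ (· ∈ ·) l Us := by
        clear h2
        induction Us with
        | nil => exact ⟨[], by simp, by simp⟩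
        | cons U Us ih =>
          obtain ⟨l, hl, hl'⟩ := ih fun V hV => h3 V (by simp [hV])
          obtain ⟨v, hv, hvU⟩ := Set.nonempty_iff_ne_empty.2 (h3 U (by simp))
          refine ⟨v :: l, ?_, by simp [hvU, hl']⟩
          simp only [List.mem_cons, forall_eq_or_imp]
          exact ⟨hv, hl⟩
      obtain ⟨l, hl, hl'⟩ := this
      exact ⟨l, hl, h2 l hl'⟩
  rw [this]
  refine MeasurableSet.biUnion hS fun Us hUs => ?_
  refine MeasurableSet.biInter (List.finite_toSet Us).countable fun U hU => ?_
  refine MeasurableSet.compl ?_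
  exact MeasurableSpace.measurableSet_generateFrom
    ⟨U, (TopologicalSpace.isBasis_countableBasis E).isOpen (hUs.1 U hU), rfl⟩

theorem measurable_shortestPath [MetricSpace E] [SecondCountableTopology E] [MeasurableSpace E]
    [OpensMeasurableSpace E] (hp : 0 < p) (x y : E) :
    Measurable fun A : PointSet E => shortestPath p A.points x y :=
  (measurable_shortestPath_voidSigma hp x y).mono voidSigma_le le_rfl

/-- The direct edge bounds the path length by a constant. -/
theorem integrable_shortestPath [MetricSpace E] {Ω : Type*} [MeasurableSpace Ω] {P : Measure Ω}
    [IsFiniteMeasure P] {H : Ω → Set E} {x y : E}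
    (h : AEMeasurable (fun ω => shortestPath p (H ω) x y) P) :
    Integrable (fun ω => shortestPath p (H ω) x y) P :=
  Integrable.of_bound h.aestronglyMeasurable (dist x y ^ p) (ae_of_all _ fun ω => by
    rw [Real.norm_of_nonneg (shortestPath_nonneg _ _ _ _)]
    exact shortestPath_le_dist _ _ _ _)

theorem PointSet.measurable_inter [MeasurableSpace E] {B : Set E} (hB : MeasurableSet B) :
    Measurable fun A : PointSet E => PointSet.mk (A.points ∩ B) := by
  refine PointSet.measurable_iff.2 fun B' hB' => ?_
  simp only [Set.inter_assoc]
  exact PointSet.measurable_encard (hB.inter hB')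

theorem PointSet.measurable_image [MeasurableSpace E] {S : E → E} (hS : Measurable S)
    (hinj : S.Injective) :
    Measurable fun A : PointSet E => PointSet.mk (S '' A.points) := by
  refine PointSet.measurable_iff.2 fun B hB => ?_
  simp only [← Set.image_inter_preimage, hinj.encard_image]
  exact PointSet.measurable_encard (hS hB)

theorem PointSet.measurable_range [MeasurableSpace E] [MeasurableEq E] (n : ℕ) :
    Measurable fun u : Fin n → E => PointSet.mk (Set.range u) := by
  classical
  refine PointSet.measurable_iff.2 fun B hB => ?_
  -- A repeated value is counted once, at its first index.
  have key : (fun u : Fin n → E => (Set.range u ∩ B).encard) =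
      (fun k : ℕ => (k : ℕ∞)) ∘ fun u : Fin n → E =>
        ∑ i, if u i ∈ B ∧ ∀ j < i, u j ≠ u i then 1 else 0 := by
    funext u
    simp only [Function.comp]
    rw [Finset.sum_boole, Nat.cast_id]
    have himg : Set.range u ∩ B =
        ((Finset.univ.filter fun i => u i ∈ B ∧ ∀ j < i, u j ≠ u i).image u : Finset E) := by
      ext v
      simp only [Set.mem_inter_iff, Set.mem_range, Finset.coe_image, Finset.coe_filter,
        Finset.mem_univ, true_and, Set.mem_image, Set.mem_ofPred_eq]
      constructor
      · rintro ⟨⟨i, rfl⟩, hi⟩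
        induction i using WellFoundedLT.induction with
        | _ i ih =>
          by_cases h : ∃ j < i, u j = u i
          · obtain ⟨j, hj, hji⟩ := h
            rw [← hji] at hi ⊢
            exact ih j hj hi
          · push Not at h
            exact ⟨i, ⟨hi, h⟩, rfl⟩
      · rintro ⟨i, hi, rfl⟩
        exact ⟨⟨i, rfl⟩, hi.1⟩
    rw [himg, Set.encard_coe_eq_coe_finsetCard, Finset.card_image_of_injOn]
    intro i hi j hj hij
    simp only [Finset.coe_filter, Finset.mem_univ, true_and, Set.mem_ofPred_eq] at hi hj
    rcases lt_trichotomy i j with h | h | h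
    · exact absurd hij (hj.2 i h)
    · exact h
    · exact absurd hij.symm (hi.2 j h)
  simp only
  rw [key]
  suffices h : Measurable fun u : Fin n → E =>
      ∑ i, if u i ∈ B ∧ ∀ j < i, u j ≠ u i then 1 else 0 from
    fun s _ => h (MeasurableSet.of_discrete (s := (fun k : ℕ => (k : ℕ∞)) ⁻¹' s))
  refine Finset.measurable_sum _ fun i _ => Measurable.ite ?_ measurable_const measurable_const
  have : {u : Fin n → E | u i ∈ B ∧ ∀ j < i, u j ≠ u i} =
      (fun u => u i) ⁻¹' B ∩ ⋂ j, ⋂ _ : j < i, {u : Fin n → E | u j = u i}ᶜ := by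
    ext u; simp
  rw [this]
  refine (measurable_pi_apply i hB).inter (MeasurableSet.iInter fun j =>
    MeasurableSet.iInter fun _ => (measurableSet_eq_fun ?_ ?_).compl)
  · exact measurable_pi_apply j
  · exact measurable_pi_apply i

end Void

/-! ### Void probabilities and invariance of the Poisson law. -/

section PoissonLaw

variable {d : ℕ} {p : ℝ}

theorem aemeasurable_poissonKernel {B : Set (EuclideanSpace ℝ (Fin d))} (μ : Measure ℕ) :
    AEMeasurable (fun n : ℕ => (Measure.pi fun _ : Fin n => cond volume B).map
      fun u => PointSet.mk (Set.range u)) μ :=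
  Measurable.of_discrete.aemeasurable

theorem poissonLaw_apply (lam : ℝ≥0) (B : Set (EuclideanSpace ℝ (Fin d)))
    {s : Set (PointSet (EuclideanSpace ℝ (Fin d)))} (hs : MeasurableSet s) :
    poissonLaw lam B s = ∑' n : ℕ, ENNReal.ofReal
      (Real.exp (-(lam * (volume B).toNNReal : ℝ≥0)) *
        (lam * (volume B).toNNReal : ℝ≥0) ^ n / n.factorial) *
      (Measure.pi fun _ : Fin n => cond volume B)
        ((fun u => PointSet.mk (Set.range u)) ⁻¹' s) := by
  rw [poissonLaw, Measure.bind_apply hs (aemeasurable_poissonKernel _), lintegral_countable']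
  refine tsum_congr fun n => ?_
  rw [poissonMeasure_singleton, Measure.map_apply (PointSet.measurable_range n) hs, mul_comm]

/-- Given `n` points, all miss `U` with probability `q ^ n`, where `q` is the proportion of `B`
outside `U`; the exponential series sums to `exp (-Λ * (1 - q))`. -/
theorem poissonLaw_voidEvent (lam : ℝ≥0) {B U : Set (EuclideanSpace ℝ (Fin d))}
    (hB : MeasurableSet B) (hBv : volume B ≠ ∞) (hU : MeasurableSet U) :
    poissonLaw lam B (voidEvent U) =
      ENNReal.ofReal (Real.exp (-(lam * volume.real (B ∩ U)))) := by
  rw [poissonLaw_apply lam B (measurableSet_voidEvent hU)]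
  set Λ : ℝ≥0 := lam * (volume B).toNNReal with hΛ
  set q : ℝ := (cond volume B).real Uᶜ with hq
  have hΛB : (Λ : ℝ) = lam * volume.real B := by simp [hΛ, measureReal_def, ENNReal.toReal]
  have hqB : q = (volume.real B)⁻¹ * volume.real (B \ U) := by
    rw [hq, measureReal_def, cond_apply hB, ENNReal.toReal_mul, ENNReal.toReal_inv,
      ← Set.sdiff_eq]
    rfl
  have hfin : (cond volume B) Uᶜ ≠ ∞ := by
    rw [cond_apply hB]
    by_cases h0 : volume B = 0
    · simp [measure_mono_null Set.inter_subset_left h0]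
    · exact ENNReal.mul_ne_top (ENNReal.inv_ne_top.2 h0)
        (ne_top_of_le_ne_top hBv (measure_mono Set.inter_subset_left))
  have hΛq : (Λ : ℝ) * q = lam * volume.real (B \ U) := by
    rw [hΛB, hqB]
    -- When `B` is null the conditional measure is zero, but so is `Λ`, and both sides vanish.
    by_cases h0 : volume.real B = 0
    · have : volume.real (B \ U) = 0 :=
        le_antisymm (h0 ▸ measureReal_mono Set.sdiff_subset hBv) measureReal_nonneg
      simp [h0, this]
    · field_simp
  have hterm : ∀ n : ℕ, ENNReal.ofReal (Real.exp (-Λ) * Λ ^ n / n.factorial) *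
      (Measure.pi fun _ : Fin n => cond volume B)
        ((fun u => PointSet.mk (Set.range u)) ⁻¹' voidEvent U) =
      ENNReal.ofReal (Real.exp (-Λ) * ((Λ * q) ^ n / n.factorial)) := fun n => by
    have hpre : (fun u : Fin n → _ => PointSet.mk (Set.range u)) ⁻¹' voidEvent U =
        Set.univ.pi fun _ : Fin n => Uᶜ := by
      ext u
      simp only [voidEvent, Set.mem_preimage, Set.mem_ofPred_eq, ← Set.disjoint_iff_inter_eq_empty,
        Set.disjoint_left, Set.mem_range, Set.mem_pi, Set.mem_compl_iff]
      exact ⟨fun h i _ => h ⟨i, rfl⟩, by rintro h _ ⟨i, rfl⟩; exact h i trivial⟩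
    rw [hpre, Measure.pi_pi, Finset.prod_const, Finset.card_univ, Fintype.card_fin,
      ← ENNReal.ofReal_toReal hfin, ← ENNReal.ofReal_pow ENNReal.toReal_nonneg,
      ← ENNReal.ofReal_mul (by positivity)]
    congr 1
    change _ * q ^ n = _
    rw [mul_pow]; ring
  simp_rw [hterm]
  have hq0 : 0 ≤ q := measureReal_nonneg
  rw [← ENNReal.ofReal_tsum_of_nonneg (fun n => by positivity)
    ((Real.summable_pow_div_factorial _).mul_left _), tsum_mul_left,
    ← congrFun (NormedSpace.exp_eq_tsum_div (𝔸 := ℝ)) (Λ * q), ← Real.exp_eq_exp_ℝ,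
    ← Real.exp_add, hΛq, hΛB]
  congr 2
  have := measureReal_inter_add_sdiff (μ := volume) (s := B) hU hBv
  rw [← this]; ring

theorem isProbabilityMeasure_poissonLaw (lam : ℝ≥0) {B : Set (EuclideanSpace ℝ (Fin d))}
    (hB : MeasurableSet B) (hBv : volume B ≠ ∞) : IsProbabilityMeasure (poissonLaw lam B) := by
  constructor
  have := poissonLaw_voidEvent lam hB hBv MeasurableSet.empty
  simpa [voidEvent] using this

/-- The mean of `L(x, y; H)` for the points in `B` of a Poisson process of intensity `lam`. -/
noncomputable def meanPath (p : ℝ) (lam : ℝ≥0) (B : Set (EuclideanSpace ℝ (Fin d)))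
    (x y : EuclideanSpace ℝ (Fin d)) : ℝ :=
  ∫ A, shortestPath p A.points x y ∂poissonLaw lam B

/-- The points of `B` that fall in `B'` have the void probabilities of the Poisson law on `B'`, and
these determine the mean. -/
theorem integral_poissonLaw_inter (hp : 0 < p) (lam : ℝ≥0) {B B' : Set (EuclideanSpace ℝ (Fin d))}
    (hB : MeasurableSet B) (hBv : volume B ≠ ∞) (hB' : MeasurableSet B') (h : B' ⊆ B)
    (x y : EuclideanSpace ℝ (Fin d)) :
    ∫ A, shortestPath p (A.points ∩ B') x y ∂poissonLaw lam B = meanPath p lam B' x y := by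
  have hBv' : volume B' ≠ ∞ := ne_top_of_le_ne_top hBv (measure_mono h)
  have := isProbabilityMeasure_poissonLaw lam hB hBv
  have := isProbabilityMeasure_poissonLaw lam hB' hBv'
  have hm := PointSet.measurable_inter hB'
  have hprob := Measure.isProbabilityMeasure_map (μ := poissonLaw lam B) hm.aemeasurable
  rw [meanPath, ← integral_eq_of_voidEvent (μ := (poissonLaw lam B).map fun A =>
      PointSet.mk (A.points ∩ B'))
    (fun U hU => ?_) (measurable_shortestPath_voidSigma hp x y),
    integral_map hm.aemeasurable (measurable_shortestPath hp x y).aestronglyMeasurable]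
  rw [Measure.map_apply hm (measurableSet_voidEvent hU.measurableSet)]
  have : (fun A : PointSet _ => PointSet.mk (A.points ∩ B')) ⁻¹' voidEvent U =
      voidEvent (B' ∩ U) := by
    ext A; simp [voidEvent, Set.inter_assoc]
  rw [this, poissonLaw_voidEvent lam hB hBv (hB'.inter hU.measurableSet),
    poissonLaw_voidEvent lam hB' hBv' hU.measurableSet, ← Set.inter_assoc,
    Set.inter_eq_self_of_subset_right h]

theorem integrable_shortestPath_inter (hp : 0 < p) (lam : ℝ≥0)
    {B B' : Set (EuclideanSpace ℝ (Fin d))}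
    (hB : MeasurableSet B) (hBv : volume B ≠ ∞) (hB' : MeasurableSet B')
    (x y : EuclideanSpace ℝ (Fin d)) :
    Integrable (fun A => shortestPath p (A.points ∩ B') x y) (poissonLaw lam B) := by
  have := isProbabilityMeasure_poissonLaw lam hB hBv
  exact integrable_shortestPath
    ((measurable_shortestPath hp x y).comp (PointSet.measurable_inter hB')).aemeasurable

theorem integrable_shortestPath_poissonLaw (hp : 0 < p) (lam : ℝ≥0)
    {B : Set (EuclideanSpace ℝ (Fin d))}
    (hB : MeasurableSet B) (hBv : volume B ≠ ∞) (x y : EuclideanSpace ℝ (Fin d)) :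
    Integrable (fun A => shortestPath p A.points x y) (poissonLaw lam B) := by
  have := isProbabilityMeasure_poissonLaw lam hB hBv
  exact integrable_shortestPath (measurable_shortestPath hp x y).aemeasurable

theorem meanPath_nonneg (p : ℝ) (lam : ℝ≥0) (B : Set (EuclideanSpace ℝ (Fin d)))
    (x y : EuclideanSpace ℝ (Fin d)) : 0 ≤ meanPath p lam B x y :=
  integral_nonneg fun _ => shortestPath_nonneg _ _ _ _

/-- Both means are realised on the configuration in `B`, where dropping the points outside `B'` can
only lengthen paths. -/
theorem meanPath_anti (hp : 0 < p) (lam : ℝ≥0) {B B' : Set (EuclideanSpace ℝ (Fin d))}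
    (hB : MeasurableSet B) (hBv : volume B ≠ ∞) (hB' : MeasurableSet B') (h : B' ⊆ B)
    (x y : EuclideanSpace ℝ (Fin d)) : meanPath p lam B x y ≤ meanPath p lam B' x y := by
  rw [← integral_poissonLaw_inter hp lam hB hBv hB' h x y]
  exact integral_mono (integrable_shortestPath_poissonLaw hp lam hB hBv x y)
    (integrable_shortestPath_inter hp lam hB hBv hB' x y)
    fun A => shortestPath_anti Set.inter_subset_left x y

/-- Similarity invariance of the mean path length. -/
theorem meanPath_image (hp : 0 < p) (lam : ℝ≥0) {B : Set (EuclideanSpace ℝ (Fin d))}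
    (hB : MeasurableSet B) (hBv : volume B ≠ ∞)
    (S : EuclideanSpace ℝ (Fin d) ≃ₜ EuclideanSpace ℝ (Fin d)) {r : ℝ≥0} (hr : 0 < r)
    (hS : ∀ x y, dist (S x) (S y) = r * dist x y)
    (hvol : ∀ s, volume (S '' s) = ENNReal.ofReal (r ^ d) * volume s)
    (x y : EuclideanSpace ℝ (Fin d)) :
    meanPath p lam (S '' B) (S x) (S y) = r ^ p * meanPath p (lam * r ^ d) B x y := by
  have hSB : MeasurableSet (S '' B) := S.measurableEmbedding.measurableSet_image.2 hB
  have hSBv : volume (S '' B) ≠ ∞ := by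
    rw [hvol]; exact ENNReal.mul_ne_top ENNReal.ofReal_ne_top hBv
  have := isProbabilityMeasure_poissonLaw lam hSB hSBv
  have := isProbabilityMeasure_poissonLaw (lam * r ^ d) hB hBv
  have hm := PointSet.measurable_image S.measurable S.injective
  have hprob := Measure.isProbabilityMeasure_map (μ := poissonLaw (lam * r ^ d) B) hm.aemeasurable
  rw [meanPath, ← integral_eq_of_voidEvent (μ := (poissonLaw (lam * r ^ d) B).map fun A =>
      PointSet.mk (S '' A.points))
    (fun U hU => ?_) (measurable_shortestPath_voidSigma hp _ _),
    integral_map hm.aemeasurable (measurable_shortestPath hp _ _).aestronglyMeasurable]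
  · simp only [shortestPath_image (NNReal.coe_pos.2 hr) hS]
    rw [integral_const_mul]
    rfl
  · rw [Measure.map_apply hm (measurableSet_voidEvent hU.measurableSet)]
    have : (fun A : PointSet _ => PointSet.mk (S '' A.points)) ⁻¹' voidEvent U =
        voidEvent (S ⁻¹' U) := by
      ext A
      simp only [voidEvent, Set.mem_preimage, Set.mem_ofPred_eq]
      rw [← Set.image_inter_preimage, Set.image_eq_empty]
    rw [this, poissonLaw_voidEvent _ hB hBv (S.measurable hU.measurableSet),
      poissonLaw_voidEvent lam hSB hSBv hU.measurableSet, ← Set.image_inter_preimage,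
      measureReal_def volume (S '' _), hvol, ENNReal.toReal_mul,
      ENNReal.toReal_ofReal (by positivity), ← measureReal_def]
    push_cast
    rw [mul_assoc]

end PoissonLaw

/-! ### Approximate subadditivity of the mean path length. -/

section Chain

variable {d : ℕ} {p : ℝ}

theorem meanPath_smul (hp : 0 < p) (lam : ℝ≥0) {B : Set (EuclideanSpace ℝ (Fin d))}
    (hB : MeasurableSet B) (hBv : volume B ≠ ∞) {r : ℝ≥0} (hr : 0 < r)
    (x y : EuclideanSpace ℝ (Fin d)) :
    meanPath p lam ((fun w => (r : ℝ) • w) '' B) ((r : ℝ) • x) ((r : ℝ) • y) =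
      r ^ p * meanPath p (lam * r ^ d) B x y := by
  have hr' : (r : ℝ) ≠ 0 := (NNReal.coe_pos.2 hr).ne'
  refine meanPath_image hp lam hB hBv (Homeomorph.smulOfNeZero (r : ℝ) hr') hr
    (fun x y => ?_) (fun s => ?_) x y
  · simp [dist_smul₀]
  · have := Measure.addHaar_smul volume (r : ℝ) s
    rw [finrank_euclideanSpace_fin, abs_of_nonneg (by positivity)] at this
    exact this

/-- The mean path length inside a ball around one end depends only on the distance of the ends. -/
theorem meanPath_ball_eq (hp : 0 < p) (lam : ℝ≥0) {e : EuclideanSpace ℝ (Fin d)} (he : ‖e‖ = 1)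
    (R : ℝ) (x y : EuclideanSpace ℝ (Fin d)) :
    meanPath p lam (Metric.ball x R) x y = meanPath p lam (Metric.ball 0 R) 0 (dist x y • e) := by
  have hn : ‖dist x y • e‖ = ‖y - x‖ := by
    rw [norm_smul, he, mul_one, Real.norm_of_nonneg dist_nonneg, dist_eq_norm']
  -- Reflection in the bisecting hyperplane exchanges two vectors of equal norm.
  let f := (Submodule.span ℝ {dist x y • e - (y - x)})ᗮ.reflection
  have hf : f (dist x y • e) = y - x := Submodule.reflection_sub hn
  let S : EuclideanSpace ℝ (Fin d) ≃ₜ EuclideanSpace ℝ (Fin d) :=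
    f.toHomeomorph.trans (Homeomorph.addLeft x)
  have hS : ∀ w, S w = x + f w := fun w => rfl
  have := meanPath_image hp lam measurableSet_ball measure_ball_lt_top.ne S
    (B := Metric.ball 0 R) (r := 1) zero_lt_one
    (fun a b => by rw [hS, hS, dist_add_left, f.dist_map, NNReal.coe_one, one_mul])
    (fun s => by
      have : S '' s = (fun w => x + w) '' (f '' s) := by rw [Set.image_image]; rfl
      rw [this, Set.image_add_left, measure_preimage_add, f.image_eq_preimage_symm,
        f.symm.measurePreserving.measure_preimage_emb
          f.symm.toHomeomorph.measurableEmbedding]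
      simp) 0 (dist x y • e)
  rw [hS, hS, hf, map_zero, add_zero, add_sub_cancel] at this
  have himg : S '' Metric.ball 0 R = Metric.ball x R := by
    have : S '' Metric.ball 0 R = (fun w => x + w) '' (f '' Metric.ball 0 R) := by
      rw [Set.image_image]; rfl
    rw [this, f.image_ball, map_zero, Set.image_add_left]
    simp
  rw [himg] at this
  simpa using this

/-- A functional that dominates `dist w A ^ p`, truncated at radius `M`. -/
noncomputable def gapSum (p : ℝ) (M : ℕ) (w : EuclideanSpace ℝ (Fin d))
    (A : PointSet (EuclideanSpace ℝ (Fin d))) : ℝ :=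
  ∑ k ∈ Finset.range (M + 1),
    (voidEvent (Metric.ball w (k : ℝ))).indicator (fun _ => ((k : ℝ) + 1) ^ p) A

theorem gapSum_nonneg (p : ℝ) (M : ℕ) (w : EuclideanSpace ℝ (Fin d))
    (A : PointSet (EuclideanSpace ℝ (Fin d))) : 0 ≤ gapSum p M w A :=
  Finset.sum_nonneg fun _ _ => Set.indicator_nonneg (fun _ _ => by positivity) _

theorem le_gapSum {M k : ℕ} (hk : k ≤ M) {w : EuclideanSpace ℝ (Fin d)}
    {A : PointSet (EuclideanSpace ℝ (Fin d))} (h : A ∈ voidEvent (Metric.ball w (k : ℝ))) :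
    ((k : ℝ) + 1) ^ p ≤ gapSum p M w A := by
  have := Finset.single_le_sum (f := fun k : ℕ =>
    (voidEvent (Metric.ball w (k : ℝ))).indicator (fun _ => ((k : ℝ) + 1) ^ p) A)
    (fun _ _ => Set.indicator_nonneg (fun _ _ => by positivity) _)
    (Finset.mem_range.2 (Nat.lt_succ_of_le hk))
  simp only [Set.indicator_of_mem h] at this
  exact this

/-- If `k + 1` is the first radius whose ball is hit, the empty ball of radius `k` contributes `(k +
1) ^ p`, which bounds the distance to a point. If even the ball of radius `M` is empty, its term
alone is `(M + 1) ^ p`. -/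
theorem exists_dist_le_gapSum (hp : 0 < p) (M : ℕ) (w : EuclideanSpace ℝ (Fin d))
    (A : PointSet (EuclideanSpace ℝ (Fin d))) :
    (∃ q ∈ A.points, dist w q ^ p ≤ gapSum p M w A) ∨ ((M : ℝ) + 1) ^ p ≤ gapSum p M w A := by
  classical
  by_cases h : A ∈ voidEvent (Metric.ball w (M : ℝ))
  · exact Or.inr (le_gapSum le_rfl h)
  left
  have hex : ∃ k : ℕ, A ∉ voidEvent (Metric.ball w (k : ℝ)) := ⟨M, h⟩
  have hk := Nat.find_spec hex
  have hkM := Nat.find_min' hex h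
  have hmin := fun m => Nat.find_min hex (m := m)
  generalize Nat.find hex = k at hk hkM hmin
  obtain _ | k := k
  · exact absurd (by simp [voidEvent]) hk
  have h' : A ∈ voidEvent (Metric.ball w (k : ℝ)) := not_not.1 (hmin k (Nat.lt_succ_self k))
  obtain ⟨q, hq, hqw⟩ := Set.nonempty_iff_ne_empty.2 hk
  refine ⟨q, hq, le_trans (Real.rpow_le_rpow dist_nonneg ?_ hp.le) (le_gapSum (by omega) h')⟩
  rw [dist_comm]
  exact_mod_cast (Metric.mem_ball.1 hqw).le

theorem integrable_gapSum (M : ℕ) (w : EuclideanSpace ℝ (Fin d))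
    (μ : Measure (PointSet (EuclideanSpace ℝ (Fin d)))) [IsFiniteMeasure μ] :
    Integrable (gapSum p M w) μ :=
  integrable_finsetSum _ fun _ _ =>
    (integrable_const _).indicator (measurableSet_voidEvent measurableSet_ball)

/-- A ball of radius `k` inside `B` is empty with probability `exp (-v * k ^ d) ≤ exp (-v * k)`, `v`
being the volume of the unit ball. The series `∑ (k + 1) ^ p * exp (-v * k)` is a bound free of `M`,
`w` and `B`. -/
theorem exists_integral_gapSum_le (hd : d ≠ 0) (p : ℝ) :
    ∃ K : ℝ, 0 < K ∧ ∀ (M : ℕ) (w : EuclideanSpace ℝ (Fin d))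
      (B : Set (EuclideanSpace ℝ (Fin d))), MeasurableSet B → volume B ≠ ∞ →
      Metric.ball w (M : ℝ) ⊆ B → ∫ A, gapSum p M w A ∂poissonLaw 1 B ≤ K := by
  set v : ℝ := volume.real (Metric.ball (0 : EuclideanSpace ℝ (Fin d)) 1) with hv
  have hv0 : 0 < v := ENNReal.toReal_pos (Metric.measure_ball_pos _ _ one_pos).ne'
    measure_ball_lt_top.ne
  have hsum : Summable fun k : ℕ => ((k : ℝ) + 1) ^ p * Real.exp (-v * k) := by
    have h1 := ((summable_nat_add_iff 1).2
      (Real.summable_pow_mul_exp_neg_nat_mul ⌈p⌉₊ hv0)).mul_left (Real.exp v)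
    refine h1.of_nonneg_of_le (fun k => by positivity) fun k => ?_
    have h2 : Real.exp v * (((k + 1 : ℕ) : ℝ) ^ ⌈p⌉₊ * Real.exp (-v * (k + 1 : ℕ))) =
        ((k : ℝ) + 1) ^ ⌈p⌉₊ * Real.exp (-v * k) := by
      rw [mul_left_comm, ← Real.exp_add]
      push_cast
      ring_nf
    rw [h2]
    gcongr
    rw [← Real.rpow_natCast]
    exact Real.rpow_le_rpow_of_exponent_le (by linarith [(k.cast_nonneg : (0 : ℝ) ≤ k)])
      (Nat.le_ceil p)
  refine ⟨_, hsum.tsum_pos (fun k => by positivity) 0 (by simp), fun M w B hB hBv hw => ?_⟩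
  have := isProbabilityMeasure_poissonLaw 1 hB hBv
  simp only [gapSum]
  rw [integral_finsetSum _ fun _ _ =>
    (integrable_const _).indicator (measurableSet_voidEvent measurableSet_ball)]
  refine le_trans (Finset.sum_le_sum fun k hk => ?_)
    (hsum.sum_le_tsum (Finset.range (M + 1)) fun k _ => by positivity)
  rw [integral_indicator_const _ (measurableSet_voidEvent measurableSet_ball), smul_eq_mul,
    mul_comm, measureReal_def, poissonLaw_voidEvent 1 hB hBv measurableSet_ball,
    ENNReal.toReal_ofReal (Real.exp_nonneg _)]
  have hkM : (k : ℝ) ≤ M := by exact_mod_cast Nat.lt_succ_iff.1 (Finset.mem_range.1 hk)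
  rw [Set.inter_eq_self_of_subset_right ((Metric.ball_subset_ball hkM).trans hw)]
  gcongr
  rw [NNReal.coe_one, one_mul, neg_mul, neg_le_neg_iff]
  rcases Nat.eq_zero_or_pos k with rfl | hk0
  · simp
  · have hk0' : (0 : ℝ) < k := by exact_mod_cast hk0
    rw [measureReal_def, Measure.addHaar_ball_of_pos _ _ hk0', finrank_euclideanSpace_fin,
      ENNReal.toReal_mul, ENNReal.toReal_ofReal (by positivity), ← measureReal_def, ← hv, mul_comm]
    gcongr
    exact_mod_cast Nat.le_self_pow hd k

/-- The points at distance `s, 2 * s, …` from `x` on the way to `y`, followed by `y`. -/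
noncomputable def stepPoint (x y : EuclideanSpace ℝ (Fin d)) (s : ℝ) (i : ℕ) :
    EuclideanSpace ℝ (Fin d) :=
  AffineMap.lineMap x y (min 1 (i * s / dist x y))

theorem stepPoint_mem (x y : EuclideanSpace ℝ (Fin d)) {s : ℝ} (hs : 0 < s) (i : ℕ) :
    stepPoint x y s i ∈ segment ℝ x y := by
  rw [segment_eq_image_lineMap]
  exact ⟨_, ⟨le_min zero_le_one (by positivity), min_le_left _ _⟩, rfl⟩

/-- Either every interior division point has a point of `A` within its gap bound, and paths are
chained through these points; or some division point sees only empty balls up to radius `M`, and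
then its gap sum alone, multiplied by `κ ^ p`, pays for the direct edge from `x` to `y`. -/
theorem shortestPath_le_steps (hp : 1 < p) {τ κ : ℝ} (h0 : 0 < τ) (h1 : τ < 1) (hκ : 0 ≤ κ)
    {x y : EuclideanSpace ℝ (Fin d)} (X : ℕ → EuclideanSpace ℝ (Fin d)) (m M : ℕ)
    (hX0 : X 0 = x) (hXm : X (m + 1) = y) (hM : dist x y ≤ κ * (M + 1))
    (A : PointSet (EuclideanSpace ℝ (Fin d))) :
    shortestPath p A.points x y ≤ ∑ i ∈ Finset.range (m + 1),
      ((τ ^ (1 - p)) ^ 2 * shortestPath p A.points (X i) (X (i + 1)) +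
        (τ ^ (1 - p) * (1 - τ) ^ (1 - p) + κ ^ p) *
          (gapSum p M (X i) A + gapSum p M (X (i + 1)) A)) := by
  have hp0 : 0 < p := by linarith
  have hT : 0 ≤ τ ^ (1 - p) := Real.rpow_nonneg h0.le _
  have hT' : 0 ≤ (1 - τ) ^ (1 - p) := Real.rpow_nonneg (by linarith) _
  have hκp : 0 ≤ κ ^ p := Real.rpow_nonneg hκ _
  have hnn : ∀ i ∈ Finset.range (m + 1), 0 ≤
      ((τ ^ (1 - p)) ^ 2 * shortestPath p A.points (X i) (X (i + 1)) +
        (τ ^ (1 - p) * (1 - τ) ^ (1 - p) + κ ^ p) *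
          (gapSum p M (X i) A + gapSum p M (X (i + 1)) A)) := fun i _ => by
    have := gapSum_nonneg p M (X i) A
    have := gapSum_nonneg p M (X (i + 1)) A
    have := shortestPath_nonneg p A.points (X i) (X (i + 1))
    positivity
  by_cases hall : ∀ i, ∃ q, (0 < i → i < m + 1 → q ∈ A.points) ∧
      ((i = 0 ∨ i = m + 1) → q = X i) ∧ (i ≤ m + 1 → dist (X i) q ^ p ≤ gapSum p M (X i) A)
  · choose q hqA hqX hqd using hall
    have := shortestPath_chain hp h0 h1 (A := A.points) X q (m + 1) hqA
    rw [hqX 0 (Or.inl rfl), hqX (m + 1) (Or.inr rfl), hX0, hXm] at this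
    refine this.trans (Finset.sum_le_sum fun i hi => ?_)
    have hi' := Finset.mem_range.1 hi
    have ha := hqd i (by omega)
    have hb := hqd (i + 1) (by omega)
    have hg := gapSum_nonneg p M (X i) A
    have hg' := gapSum_nonneg p M (X (i + 1)) A
    gcongr
    linarith
  · push Not at hall
    obtain ⟨i, hi⟩ := hall
    -- At any other index `q = X i` qualifies, with displacement 0.
    have hi0 : 0 < i ∧ i < m + 1 := by
      by_contra hcon
      have h2 := hi (X i) (fun h3 h4 => absurd ⟨h3, h4⟩ hcon) (fun _ => rfl)
      have h3 := gapSum_nonneg p M (X i) A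
      rw [dist_self, Real.zero_rpow hp0.ne'] at h2
      linarith [h2.2]
    have hbig : ((M : ℝ) + 1) ^ p ≤ gapSum p M (X i) A := by
      rcases exists_dist_le_gapSum hp0 M (X i) A with ⟨q, hq, hqd⟩ | h
      · have h2 := hi q (fun _ _ => hq) (fun h => by omega)
        linarith [h2.2]
      · exact h
    refine le_trans ?_ (Finset.single_le_sum hnn (Finset.mem_range.2 hi0.2))
    have h3 : dist x y ^ p ≤ κ ^ p * ((M : ℝ) + 1) ^ p := by
      rw [← Real.mul_rpow hκ (by positivity)]
      exact Real.rpow_le_rpow dist_nonneg hM hp0.le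
    have h4 := shortestPath_le_dist p A.points x y
    have h5 := shortestPath_nonneg p A.points (X i) (X (i + 1))
    have h6 := gapSum_nonneg p M (X (i + 1)) A
    have h7 := gapSum_nonneg p M (X i) A
    have h8 : κ ^ p * ((M : ℝ) + 1) ^ p ≤ κ ^ p * gapSum p M (X i) A := by gcongr
    have h9 : 0 ≤ τ ^ (1 - p) * (1 - τ) ^ (1 - p) *
        (gapSum p M (X i) A + gapSum p M (X (i + 1)) A) := by positivity
    have h10 : 0 ≤ (τ ^ (1 - p)) ^ 2 * shortestPath p A.points (X i) (X (i + 1)) := by positivity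
    have h11 : 0 ≤ κ ^ p * gapSum p M (X (i + 1)) A := by positivity
    linarith

/-- Approximate subadditivity of the mean path length. -/
theorem exists_meanPath_le_steps (hd : d ≠ 0) (hp : 1 < p) {τ κ : ℝ} (h0 : 0 < τ) (h1 : τ < 1)
    (hκ : 0 ≤ κ) {e : EuclideanSpace ℝ (Fin d)} (he : ‖e‖ = 1) :
    ∃ K : ℝ, 0 < K ∧ ∀ (s R : ℝ) (M : ℕ) (B : Set (EuclideanSpace ℝ (Fin d)))
      (x y : EuclideanSpace ℝ (Fin d)), 0 < s → MeasurableSet B → volume B ≠ ∞ →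
      (∀ w ∈ segment ℝ x y, Metric.ball w R ⊆ B ∧ Metric.ball w (M : ℝ) ⊆ B) →
      dist x y ≤ κ * (M + 1) →
      meanPath p 1 B x y ≤
        (τ ^ (1 - p)) ^ 2 *
          (dist x y / s * meanPath p 1 (Metric.ball 0 R) 0 (s • e) + s ^ p) +
        K * (dist x y / s + 1) := by
  have hp0 : 0 < p := by linarith
  obtain ⟨K₀, hK₀, hK⟩ := exists_integral_gapSum_le hd p
  set T := τ ^ (1 - p) with hT
  set C := T * (1 - τ) ^ (1 - p) + κ ^ p with hC
  have hT0 : 0 < T := Real.rpow_pos_of_pos h0 _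
  have hC0 : 0 < C := by
    have : 0 < (1 - τ) ^ (1 - p) := Real.rpow_pos_of_pos (by linarith) _
    have := Real.rpow_nonneg hκ p
    positivity
  -- Each step carries two gap sums of mean at most `K₀`.
  refine ⟨2 * C * K₀, by positivity, fun s R M B x y hs hB hBv hw hM => ?_⟩
  have := isProbabilityMeasure_poissonLaw 1 hB hBv
  set G := meanPath p 1 (Metric.ball 0 R) 0 (s • e) with hG
  have hG0 : 0 ≤ G := meanPath_nonneg _ _ _ _ _
  rcases eq_or_ne x y with rfl | hxy
  · have h2 : meanPath p 1 B x x ≤ 0 := by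
      refine integral_nonpos fun A => ?_
      simpa [Real.zero_rpow hp0.ne'] using shortestPath_le_dist p A.points x x
    refine h2.trans ?_
    have : 0 ≤ s ^ p := Real.rpow_nonneg hs.le _
    simp only [dist_self]
    positivity
  set t := dist x y with ht
  have ht0 : 0 < t := dist_pos.2 hxy
  -- There are `m` full steps of length `s`; the last, of length at most `s`, is bounded by its
  -- direct edge.
  set m := ⌊t / s⌋₊ with hm
  have hmt : (m : ℝ) ≤ t / s := Nat.floor_le (by positivity)
  have hmt' : t / s < m + 1 := Nat.lt_floor_add_one _
  have hms : m * s ≤ t := (le_div_iff₀ hs).1 hmt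
  have hms' : t < (m + 1) * s := (div_lt_iff₀ hs).1 hmt'
  set X := stepPoint x y s with hX
  have hseg : ∀ i, X i ∈ segment ℝ x y := stepPoint_mem x y hs
  have hX0 : X 0 = x := by simp [hX, stepPoint]
  have hXm : X (m + 1) = y := by
    simp only [hX, stepPoint]
    rw [min_eq_left, AffineMap.lineMap_apply_one]
    rw [le_div_iff₀ ht0]
    push_cast
    linarith
  have hdist : ∀ i < m, dist (X i) (X (i + 1)) = s := fun i hi => by
    have hi1 : ((i : ℝ) + 1) ≤ m := by exact_mod_cast hi
    have h2 : ((i : ℝ) + 1) * s ≤ t := le_trans (by gcongr) hms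
    simp only [hX, stepPoint]
    rw [dist_lineMap_lineMap, min_eq_right, min_eq_right, dist_comm, Real.dist_eq, ← sub_div,
      abs_of_nonneg, ← ht]
    · push_cast; field_simp; ring
    · push_cast; apply div_nonneg _ ht0.le; nlinarith
    · rw [div_le_one ht0]; push_cast; exact h2
    · rw [div_le_one ht0]; nlinarith
  have hdistm : dist (X m) (X (m + 1)) ≤ s := by
    rw [hXm]
    simp only [hX, stepPoint]
    rw [min_eq_right ((div_le_one ht0).2 hms), dist_lineMap_right, Real.norm_of_nonneg, ← ht]
    · rw [sub_mul, div_mul_cancel₀ _ ht0.ne']; nlinarith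
    · rw [sub_nonneg, div_le_one ht0]; exact hms
  have hpoint : ∀ A : PointSet (EuclideanSpace ℝ (Fin d)), shortestPath p A.points x y ≤
      T ^ 2 * (∑ i ∈ Finset.range m,
        shortestPath p (A.points ∩ Metric.ball (X i) R) (X i) (X (i + 1)) + s ^ p) +
      C * ∑ i ∈ Finset.range (m + 1), (gapSum p M (X i) A + gapSum p M (X (i + 1)) A) :=
    fun A => by
    refine (shortestPath_le_steps hp h0 h1 hκ X m M hX0 hXm hM A).trans ?_
    rw [Finset.sum_add_distrib, ← Finset.mul_sum, ← Finset.mul_sum, Finset.sum_range_succ]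
    gcongr with i hi
    · exact shortestPath_anti Set.inter_subset_left _ _
    · exact (shortestPath_le_dist p _ _ _).trans
        (Real.rpow_le_rpow dist_nonneg hdistm hp0.le)
  have hint1 : ∀ i, Integrable (fun A : PointSet (EuclideanSpace ℝ (Fin d)) =>
      shortestPath p (A.points ∩ Metric.ball (X i) R) (X i) (X (i + 1))) (poissonLaw 1 B) :=
    fun i => integrable_shortestPath_inter hp0 1 hB hBv measurableSet_ball _ _
  have hint2 : ∀ i, Integrable (fun A => gapSum p M (X i) A + gapSum p M (X (i + 1)) A)
      (poissonLaw 1 B) := fun i => (integrable_gapSum _ _ _).add (integrable_gapSum _ _ _)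
  have hintS := integrable_finsetSum (Finset.range m) fun i _ => hint1 i
  have hintA : Integrable (fun A : PointSet (EuclideanSpace ℝ (Fin d)) =>
      T ^ 2 * (∑ i ∈ Finset.range m,
        shortestPath p (A.points ∩ Metric.ball (X i) R) (X i) (X (i + 1)) + s ^ p))
      (poissonLaw 1 B) := (hintS.add (integrable_const (s ^ p))).const_mul (T ^ 2)
  have hintB := (integrable_finsetSum (Finset.range (m + 1)) fun i _ => hint2 i).const_mul C
  refine (integral_mono (integrable_shortestPath_poissonLaw hp0 1 hB hBv x y)
    (hintA.add hintB) hpoint).trans ?_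
  rw [integral_add' hintA hintB, integral_const_mul, integral_const_mul,
    integral_add hintS (integrable_const _), integral_finsetSum _ fun i _ => hint1 i,
    integral_finsetSum _ fun i _ => hint2 i, integral_const]
  -- Keeping only the points within `R` of `X i` makes all full steps have the same mean, by
  -- invariance under isometries.
  have hmean : ∀ i ∈ Finset.range m, ∫ A, shortestPath p (A.points ∩ Metric.ball (X i) R) (X i)
      (X (i + 1)) ∂poissonLaw 1 B = G := fun i hi => by
    rw [integral_poissonLaw_inter hp0 1 hB hBv measurableSet_ball (hw _ (hseg i)).1,
      meanPath_ball_eq hp0 1 he, hdist i (Finset.mem_range.1 hi)]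
  rw [Finset.sum_congr rfl hmean]
  have hgap : ∀ i ∈ Finset.range (m + 1), ∫ A, (gapSum p M (X i) A + gapSum p M (X (i + 1)) A)
      ∂poissonLaw 1 B ≤ 2 * K₀ := fun i _ => by
    rw [integral_add (integrable_gapSum _ _ _) (integrable_gapSum _ _ _)]
    linarith [hK M (X i) B hB hBv (hw _ (hseg i)).2, hK M (X (i + 1)) B hB hBv (hw _ (hseg _)).2]
  have h2 := Finset.sum_le_sum hgap
  simp only [Finset.sum_const, Finset.card_range, nsmul_eq_mul, probReal_univ, one_smul] at h2 ⊢
  push_cast at h2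
  have h3 : C * ∑ i ∈ Finset.range (m + 1), ∫ A, (gapSum p M (X i) A + gapSum p M (X (i + 1)) A)
      ∂poissonLaw 1 B ≤ C * ((t / s + 1) * (2 * K₀)) := by
    refine mul_le_mul_of_nonneg_left (h2.trans ?_) hC0.le
    gcongr
  have h4 : T ^ 2 * (m * G + s ^ p) ≤ T ^ 2 * (t / s * G + s ^ p) := by gcongr
  linarith

end Chain

/-! ### Existence of the limit constant. -/

section ShortestPathConstant

variable {d : ℕ} {p : ℝ}

/-- Divided by `t`, the left side is `T * (G / s)`, plus `K / s`, plus a constant over `t`; these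
contribute at most `L + ε / 2`, `ε / 4` and `ε / 4`. -/
theorem eventually_approx_subadditive_le {p L ε T K s G : ℝ} (hT : 0 ≤ T) (hε : 0 < ε)
    (h1 : T * (L + ε / 4) ≤ L + ε / 2) (h2 : K / s ≤ ε / 4) (h3 : G / s ≤ L + ε / 4) :
    ∀ᶠ t in atTop, T * (t / s * G + s ^ p) + K * (t / s + 1) ≤ (L + ε) * t := by
  filter_upwards [eventually_ge_atTop ((T * s ^ p + K) * (4 / ε)), eventually_gt_atTop 0]
    with t ht ht0
  have h4 : T * s ^ p + K ≤ ε / 4 * t := by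
    have := mul_le_mul_of_nonneg_left ht (by positivity : 0 ≤ ε / 4)
    calc T * s ^ p + K = ε / 4 * ((T * s ^ p + K) * (4 / ε)) := by field_simp
      _ ≤ _ := this
  have h5 : T * (G / s) * t ≤ (L + ε / 2) * t :=
    mul_le_mul_of_nonneg_right ((mul_le_mul_of_nonneg_left h3 hT).trans h1) ht0.le
  have h6 : K / s * t ≤ ε / 4 * t := mul_le_mul_of_nonneg_right h2 ht0.le
  calc T * (t / s * G + s ^ p) + K * (t / s + 1)
      = T * (G / s) * t + K / s * t + (T * s ^ p + K) := by ring
    _ ≤ (L + ε / 2) * t + ε / 4 * t + ε / 4 * t := by gcongr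
    _ = (L + ε) * t := by ring

theorem exists_one_lt_mul_le {L ε : ℝ} (hL : 0 ≤ L) (hε : 0 < ε) :
    ∃ T : ℝ, 1 < T ∧ T * (L + ε / 4) ≤ L + ε / 2 := by
  refine ⟨(L + ε / 2) / (L + ε / 4), ?_, ?_⟩
  · rw [one_lt_div (by positivity)]; linarith
  · rw [div_mul_cancel₀ _ (by positivity)]

/-- Approximately subadditive functions have an average growth rate. -/
theorem exists_tendsto_div_of_approx_subadditive {g : ℝ → ℝ} (hg : ∀ t, 0 ≤ g t)
    (h : ∀ T : ℝ, 1 < T → ∃ K : ℝ, ∀ s t : ℝ, 0 < s → 0 < t →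
      g t ≤ T * (t / s * g s + s ^ p) + K * (t / s + 1)) :
    ∃ L : ℝ, 0 ≤ L ∧ Tendsto (fun t => g t / t) atTop (𝓝 L) := by
  have hbelow : ∀ᶠ t in atTop, 0 ≤ g t / t := by
    filter_upwards [eventually_gt_atTop 0] with t ht
    exact div_nonneg (hg t) ht.le
  have hbb : IsBoundedUnder (· ≥ ·) atTop fun t => g t / t := ⟨0, eventually_map.2 hbelow⟩
  have hab : IsBoundedUnder (· ≤ ·) atTop fun t => g t / t := by
    -- The case `s = 1` already gives linear growth, which makes the liminf and limsup meaningful.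
    obtain ⟨K, hK⟩ := h 2 one_lt_two
    refine ⟨2 * (g 1 + 1) + 2 * |K|, eventually_map.2 ?_⟩
    filter_upwards [eventually_ge_atTop 1] with t ht
    rw [div_le_iff₀ (by linarith)]
    have h1 := hK 1 t one_pos (by linarith)
    rw [div_one, Real.one_rpow] at h1
    have h2 : K * (t + 1) ≤ |K| * (t + 1) := by gcongr; exact le_abs_self K
    nlinarith [abs_nonneg K]
  set L := liminf (fun t => g t / t) atTop with hL
  have hL0 : 0 ≤ L := le_liminf_of_le hab.isCoboundedUnder_ge hbelow
  refine ⟨L, hL0, tendsto_of_le_liminf_of_limsup_le le_rfl ?_ hab hbb⟩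
  refine le_of_forall_pos_le_add fun ε hε => ?_
  obtain ⟨T, hT1, hT⟩ := exists_one_lt_mul_le hL0 hε
  obtain ⟨K, hK⟩ := h T hT1
  -- `T` and `K` are fixed first. The ratio comes close to its liminf at arbitrarily large `s`, so
  -- `K / s` can be made small at the same time.
  have hfr : ∃ᶠ s in atTop, g s / s < L + ε / 4 :=
    frequently_lt_of_liminf_lt hab.isCoboundedUnder_ge (by linarith)
  obtain ⟨s, hs, hs0, hsK⟩ := (hfr.and_eventually ((eventually_gt_atTop 0).and
    (eventually_ge_atTop (K * (4 / ε))))).exists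
  refine limsup_le_of_le hbb.isCoboundedUnder_le ?_
  have hKs : K / s ≤ ε / 4 := by
    rw [div_le_iff₀ hs0]
    have := mul_le_mul_of_nonneg_left hsK (by positivity : 0 ≤ ε / 4)
    calc K = ε / 4 * (K * (4 / ε)) := by field_simp
      _ ≤ _ := this
  filter_upwards [eventually_approx_subadditive_le (p := p) (by linarith) hε hT hKs hs.le,
    eventually_gt_atTop 0] with t ht ht0
  rw [div_le_iff₀ ht0]
  exact (hK s t hs0 ht0).trans ht

/-- With `τ = T ^ (-1 / (2 * (p - 1)))` the factor `(τ ^ (1 - p)) ^ 2` is `T`, so any factor above 1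
is available. -/
theorem exists_meanPath_le_of_one_lt (hd : d ≠ 0) (hp : 1 < p) {T κ : ℝ} (hT : 1 < T)
    (hκ : 0 ≤ κ) {e : EuclideanSpace ℝ (Fin d)} (he : ‖e‖ = 1) :
    ∃ K : ℝ, 0 < K ∧ ∀ (s R : ℝ) (M : ℕ) (B : Set (EuclideanSpace ℝ (Fin d)))
      (x y : EuclideanSpace ℝ (Fin d)), 0 < s → MeasurableSet B → volume B ≠ ∞ →
      (∀ w ∈ segment ℝ x y, Metric.ball w R ⊆ B ∧ Metric.ball w (M : ℝ) ⊆ B) →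
      dist x y ≤ κ * (M + 1) →
      meanPath p 1 B x y ≤
        T * (dist x y / s * meanPath p 1 (Metric.ball 0 R) 0 (s • e) + s ^ p) +
        K * (dist x y / s + 1) := by
  have hT0 : 0 < T := by linarith
  have h := exists_meanPath_le_steps hd hp (τ := T ^ (-(1 / (2 * (p - 1)))))
    (Real.rpow_pos_of_pos hT0 _)
    (Real.rpow_lt_one_of_one_lt_of_neg hT (neg_neg_of_pos (by
      have : 0 < p - 1 := by linarith
      positivity))) hκ he
  have h2 : ((T ^ (-(1 / (2 * (p - 1))))) ^ (1 - p)) ^ 2 = T := by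
    rw [← Real.rpow_mul hT0.le, ← Real.rpow_natCast, ← Real.rpow_mul hT0.le]
    have : p - 1 ≠ 0 := by linarith
    have h3 : -(1 / (2 * (p - 1))) * (1 - p) * ((2 : ℕ) : ℝ) = 1 := by
      push_cast
      field_simp
      ring
    rw [h3, Real.rpow_one]
  rwa [h2] at h

/-- The mean of `L(0, t • e; H)` for the homogeneous Poisson process `H` of unit intensity. -/
noncomputable def radialMean (p : ℝ) (e : EuclideanSpace ℝ (Fin d)) (t : ℝ) : ℝ :=
  ⨅ R : ℕ, meanPath p 1 (Metric.ball 0 (R : ℝ)) 0 (t • e)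

theorem bddBelow_radialMean (p : ℝ) (e : EuclideanSpace ℝ (Fin d)) (t : ℝ) :
    BddBelow (Set.range fun R : ℕ => meanPath p 1 (Metric.ball 0 (R : ℝ)) 0 (t • e)) :=
  ⟨0, by rintro _ ⟨R, rfl⟩; exact meanPath_nonneg _ _ _ _ _⟩

theorem radialMean_nonneg (p : ℝ) (e : EuclideanSpace ℝ (Fin d)) (t : ℝ) : 0 ≤ radialMean p e t :=
  le_ciInf fun _ => meanPath_nonneg _ _ _ _ _

theorem tendsto_meanPath_radialMean (hp : 0 < p) (e : EuclideanSpace ℝ (Fin d)) (t : ℝ) :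
    Tendsto (fun R : ℕ => meanPath p 1 (Metric.ball 0 (R : ℝ)) 0 (t • e)) atTop
      (𝓝 (radialMean p e t)) := by
  refine tendsto_atTop_ciInf (fun R R' h => ?_) (bddBelow_radialMean p e t)
  exact meanPath_anti hp 1 measurableSet_ball measure_ball_lt_top.ne measurableSet_ball
    (Metric.ball_subset_ball (by exact_mod_cast h)) _ _

/-- A bounded `B` lies in a ball about `x`, and extra points shorten paths: the boundary never
spoils the lower bound. -/
theorem radialMean_le_meanPath (hp : 0 < p) {e : EuclideanSpace ℝ (Fin d)} (he : ‖e‖ = 1)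
    {B : Set (EuclideanSpace ℝ (Fin d))} (hB : MeasurableSet B) (hb : Bornology.IsBounded B)
    (x y : EuclideanSpace ℝ (Fin d)) : radialMean p e (dist x y) ≤ meanPath p 1 B x y := by
  obtain ⟨r, hr⟩ := hb.subset_ball x
  obtain ⟨R, hR⟩ := exists_nat_ge r
  refine (ciInf_le (bddBelow_radialMean p e _) R).trans ?_
  rw [← meanPath_ball_eq hp 1 he]
  exact meanPath_anti hp 1 measurableSet_ball measure_ball_lt_top.ne hB
    (hr.trans (Metric.ball_subset_ball hR)) x y

/-- Subadditivity is applied in a ball that contains the `R`- and `⌈t⌉₊`-neighbourhoods of the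
segment. Letting `R → ∞` with `s` and `t` fixed turns the restricted mean at `s` into `radialMean`.
-/
theorem exists_tendsto_radialMean_div (hd : d ≠ 0) (hp : 1 < p) {e : EuclideanSpace ℝ (Fin d)}
    (he : ‖e‖ = 1) : ∃ L : ℝ, 0 ≤ L ∧ Tendsto (fun t => radialMean p e t / t) atTop (𝓝 L) := by
  have hp0 : 0 < p := by linarith
  refine exists_tendsto_div_of_approx_subadditive (p := p) (radialMean_nonneg p e) fun T hT => ?_
  obtain ⟨K, -, hK⟩ := exists_meanPath_le_of_one_lt (p := p) (κ := 1) hd hp hT zero_le_one he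
  refine ⟨K, fun s t hs ht => ?_⟩
  have hlim := (((tendsto_meanPath_radialMean hp0 e s).const_mul (t / s)).add_const
    (s ^ p)).const_mul T |>.add_const (K * (t / s + 1))
  refine ge_of_tendsto' hlim fun R => ?_
  have hdist : dist 0 (t • e) = t := by
    rw [dist_zero_left, norm_smul, he, mul_one, Real.norm_of_nonneg ht.le]
  have h := hK s R ⌈t⌉₊ (Metric.ball 0 ((⌈t⌉₊ + R + ⌈t⌉₊ : ℕ) : ℝ)) 0 (t • e) hs
    measurableSet_ball measure_ball_lt_top.ne (fun w hw => ?_) ?_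
  · rw [hdist] at h
    exact (ciInf_le (bddBelow_radialMean p e t) _).trans h
  · have hwt : dist w 0 ≤ t := by
      have := (convex_closedBall (0 : EuclideanSpace ℝ (Fin d)) t).segment_subset
        (Metric.mem_closedBall_self ht.le) (Metric.mem_closedBall'.2 hdist.le) hw
      exact this
    have htc := Nat.le_ceil t
    have hR0 : (0 : ℝ) ≤ R := R.cast_nonneg
    push_cast
    constructor <;> refine Metric.ball_subset_ball' ?_ <;> linarith
  · rw [hdist]
    linarith [Nat.le_ceil t]

/-- Upper bound for the mean path length in a domain that contains a neighbourhood of the segment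
between the ends. -/
theorem exists_meanPath_le_of_tendsto (hd : d ≠ 0) (hp : 1 < p) {e : EuclideanSpace ℝ (Fin d)}
    (he : ‖e‖ = 1) {L : ℝ} (hL : 0 ≤ L) (hlim : Tendsto (fun t => radialMean p e t / t) atTop (𝓝 L))
    {c ε : ℝ} (hc : 0 < c) (hε : 0 < ε) :
    ∃ R t₀ : ℝ, ∀ (B : Set (EuclideanSpace ℝ (Fin d))) (x y : EuclideanSpace ℝ (Fin d)),
      MeasurableSet B → volume B ≠ ∞ → t₀ ≤ dist x y →
      (∀ w ∈ segment ℝ x y, Metric.ball w R ⊆ B ∧ Metric.ball w (c * dist x y) ⊆ B) →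
      meanPath p 1 B x y ≤ (L + ε) * dist x y := by
  have hp0 : 0 < p := by linarith
  obtain ⟨T, hT1, hT⟩ := exists_one_lt_mul_le hL hε
  -- The value `κ = 1 / c` goes with the truncation `M = ⌊c * dist x y⌋₊`, for which `c * dist x y ≤
  -- M + 1`.
  obtain ⟨K, -, hK⟩ := exists_meanPath_le_of_one_lt (p := p) (κ := 1 / c) hd hp hT1
    (by positivity) he
  obtain ⟨s, hs, hs0, hsK⟩ := ((hlim.eventually_lt_const (by linarith : L < L + ε / 4)).and
    ((eventually_gt_atTop 0).and (eventually_ge_atTop (K * (4 / ε))))).exists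
  have hKs : K / s ≤ ε / 4 := by
    rw [div_le_iff₀ hs0]
    have := mul_le_mul_of_nonneg_left hsK (by positivity : 0 ≤ ε / 4)
    calc K = ε / 4 * (K * (4 / ε)) := by field_simp
      _ ≤ _ := this
  -- With `s` fixed, a finite `R` suffices; the clearance it demands is independent of the domain
  -- and of the ends.
  obtain ⟨R, hR⟩ := (((tendsto_meanPath_radialMean hp0 e s).div_const s).eventually_lt_const
    hs).exists
  obtain ⟨t₀, ht₀⟩ := eventually_atTop.1
    (eventually_approx_subadditive_le (p := p) (by linarith) hε hT hKs hR.le)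
  refine ⟨R, t₀, fun B x y hB hBv hxy hw => (hK s R ⌊c * dist x y⌋₊ B x y hs0 hB hBv
    (fun w hw' => ⟨(hw w hw').1, (Metric.ball_subset_ball (Nat.floor_le
      (by positivity))).trans (hw w hw').2⟩) ?_).trans (ht₀ _ hxy)⟩
  have := (Nat.lt_floor_add_one (c * dist x y)).le
  rw [one_div, inv_mul_eq_div, le_div_iff₀ hc]
  linarith

/-- A path has finitely many nodes, hence lies in some ball. -/
theorem tendsto_shortestPath_inter_ball {E : Type*} [MetricSpace E] (A : Set E)
    (x y z : E) :
    Tendsto (fun R : ℕ => shortestPath p (A ∩ Metric.ball z (R : ℝ)) x y) atTop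
      (𝓝 (shortestPath p A x y)) := by
  refine tendsto_order.2 ⟨fun c hc => Eventually.of_forall fun R =>
    hc.trans_le (shortestPath_anti Set.inter_subset_left x y), fun c hc => ?_⟩
  obtain ⟨l, hl, hlc⟩ := shortestPath_lt_iff.1 hc
  obtain ⟨R₀, hR₀⟩ : ∃ R₀ : ℕ, ∀ v ∈ l, dist v z < R₀ := by
    obtain ⟨r, hr⟩ := (List.finite_toSet l).isBounded.subset_ball z
    obtain ⟨n, hn⟩ := exists_nat_ge r
    exact ⟨n, fun v hv => (Metric.mem_ball.1 (hr hv)).trans_le hn⟩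
  filter_upwards [eventually_ge_atTop R₀] with R hR
  exact shortestPath_lt_iff.2 ⟨l, fun v hv =>
    ⟨hl v hv, (hR₀ v hv).trans_le (by exact_mod_cast hR)⟩, hlc⟩

/-- The mean path length through a homogeneous Poisson process. -/
theorem integral_shortestPath_isPoissonProcess (hp : 0 < p) {Ω : Type*} [MeasurableSpace Ω]
    {P : Measure Ω} [IsProbabilityMeasure P] {H : Ω → Set (EuclideanSpace ℝ (Fin d))}
    (hH : IsPoissonProcess 1 H P) (e : EuclideanSpace ℝ (Fin d)) (t : ℝ) :
    Integrable (fun ω => shortestPath p (H ω) 0 (t • e)) P ∧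
      ∫ ω, shortestPath p (H ω) 0 (t • e) ∂P = radialMean p e t := by
  have hlaw : ∀ R : ℕ, HasLaw (fun ω => PointSet.mk (H ω ∩ Metric.ball 0 (R : ℝ)))
      (poissonLaw 1 (Metric.ball 0 (R : ℝ))) P := fun R =>
    hH _ measurableSet_ball measure_ball_lt_top.ne
  have hmeas : ∀ R : ℕ, AEMeasurable
      (fun ω => shortestPath p (H ω ∩ Metric.ball 0 (R : ℝ)) 0 (t • e)) P := fun R =>
    (measurable_shortestPath hp 0 (t • e)).comp_aemeasurable (hlaw R).aemeasurable
  have hlim : ∀ ω, Tendsto (fun R : ℕ => shortestPath p (H ω ∩ Metric.ball 0 (R : ℝ)) 0 (t • e))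
      atTop (𝓝 (shortestPath p (H ω) 0 (t • e))) := fun ω =>
    tendsto_shortestPath_inter_ball (H ω) 0 (t • e) 0
  have hm := aemeasurable_of_tendsto_metrizable_ae' hmeas (ae_of_all _ hlim)
  refine ⟨integrable_shortestPath hm, ?_⟩
  have h1 : ∀ R : ℕ, ∫ ω, shortestPath p (H ω ∩ Metric.ball 0 (R : ℝ)) 0 (t • e) ∂P =
      meanPath p 1 (Metric.ball 0 (R : ℝ)) 0 (t • e) := fun R => by
    rw [meanPath, ← (hlaw R).map_eq, integral_map (hlaw R).aemeasurable
      (measurable_shortestPath hp _ _).aestronglyMeasurable]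
  have h2 : Tendsto (fun R : ℕ => ∫ ω, shortestPath p (H ω ∩ Metric.ball 0 (R : ℝ)) 0 (t • e) ∂P)
      atTop (𝓝 (∫ ω, shortestPath p (H ω) 0 (t • e) ∂P)) :=
    tendsto_integral_of_dominated_convergence (fun _ => dist 0 (t • e) ^ p)
      (fun R => (hmeas R).aestronglyMeasurable) (integrable_const _)
      (fun R => ae_of_all _ fun ω => by
        rw [Real.norm_of_nonneg (shortestPath_nonneg _ _ _ _)]
        exact shortestPath_le_dist _ _ _ _) (ae_of_all _ hlim)
  simp only [h1] at h2
  exact tendsto_nhds_unique h2 (tendsto_meanPath_radialMean hp e t)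

end ShortestPathConstant

/-! ### Samples of fixed size and Poissonization. -/

section Sample

variable {d : ℕ} {p : ℝ}

/-- The mean of `L(x, y; {U₁, …, Uₙ})` for independent uniform points `Uᵢ` of `B`. -/
noncomputable def sampleMean (p : ℝ) (B : Set (EuclideanSpace ℝ (Fin d))) (n : ℕ)
    (x y : EuclideanSpace ℝ (Fin d)) : ℝ :=
  ∫ u, shortestPath p (Set.range u) x y ∂Measure.pi fun _ : Fin n => cond volume B

theorem measurable_shortestPath_range (hp : 0 < p) (n : ℕ) (x y : EuclideanSpace ℝ (Fin d)) :
    Measurable fun u : Fin n → EuclideanSpace ℝ (Fin d) => shortestPath p (Set.range u) x y := by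
  have h1 := measurable_shortestPath (E := EuclideanSpace ℝ (Fin d)) hp x y
  have h2 := PointSet.measurable_range (E := EuclideanSpace ℝ (Fin d)) n
  have h3 : (fun u : Fin n → EuclideanSpace ℝ (Fin d) => shortestPath p (Set.range u) x y) =
      (fun A : PointSet (EuclideanSpace ℝ (Fin d)) => shortestPath p A.points x y) ∘
        fun u : Fin n → EuclideanSpace ℝ (Fin d) => PointSet.mk (Set.range u) := rfl
  rw [h3]
  exact h1.comp h2

theorem sampleMean_nonneg (p : ℝ) (B : Set (EuclideanSpace ℝ (Fin d))) (n : ℕ)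
    (x y : EuclideanSpace ℝ (Fin d)) : 0 ≤ sampleMean p B n x y :=
  integral_nonneg fun _ => shortestPath_nonneg _ _ _ _

theorem sampleMean_le (hp : 0 < p) {B : Set (EuclideanSpace ℝ (Fin d))}
    [IsProbabilityMeasure (cond volume B)] (n : ℕ) (x y : EuclideanSpace ℝ (Fin d)) :
    sampleMean p B n x y ≤ dist x y ^ p := by
  refine (integral_mono (integrable_shortestPath
    (measurable_shortestPath_range hp n x y).aemeasurable) (integrable_const (dist x y ^ p))
    fun u => shortestPath_le_dist _ _ _ _).trans_eq ?_
  simp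

/-- The mean path length through the first `n` points of a sequence of independent uniform points. -/
theorem integral_shortestPath_of_iIndepFun (hp : 0 < p) {Ω : Type*} [MeasurableSpace Ω]
    {P : Measure Ω} [IsProbabilityMeasure P] {ι : Type*}
    {X : ι → Ω → EuclideanSpace ℝ (Fin d)} (hX : iIndepFun X P)
    {B : Set (EuclideanSpace ℝ (Fin d))} (hlaw : ∀ i, HasLaw (X i) (cond volume B) P)
    {n : ℕ} {g : Fin n → ι} (hg : g.Injective) (x y : EuclideanSpace ℝ (Fin d)) :
    Integrable (fun ω => shortestPath p (Set.range fun i => X (g i) ω) x y) P ∧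
    ∫ ω, shortestPath p (Set.range fun i => X (g i) ω) x y ∂P = sampleMean p B n x y := by
  have hmeas : ∀ i, AEMeasurable (X (g i)) P := fun i => (hlaw _).aemeasurable
  have hpi := (iIndepFun_iff_map_fun_eq_pi_map hmeas).1 (hX.precomp hg)
  simp only [(hlaw _).map_eq] at hpi
  have hm : AEMeasurable (fun ω i => X (g i) ω) P := aemeasurable_pi_lambda _ hmeas
  refine ⟨integrable_shortestPath
    ((measurable_shortestPath_range hp n x y).comp_aemeasurable hm), ?_⟩
  rw [sampleMean, ← hpi, integral_map hm
    (measurable_shortestPath_range hp n x y).aestronglyMeasurable]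

/-- The first `n` of `m` independent points form a sample of size `n`, and more points shorten
paths. -/
theorem antitone_sampleMean (hp : 0 < p) {B : Set (EuclideanSpace ℝ (Fin d))}
    [IsProbabilityMeasure (cond volume B)] (x y : EuclideanSpace ℝ (Fin d)) :
    Antitone fun n => sampleMean p B n x y := by
  intro n m hnm
  have hind : iIndepFun (fun (i : Fin m) (u : Fin m → EuclideanSpace ℝ (Fin d)) => u i)
      (Measure.pi fun _ : Fin m => cond volume B) :=
    iIndepFun_pi (X := fun _ u => u) fun _ => aemeasurable_id
  have hlaw : ∀ i : Fin m, HasLaw (fun u : Fin m → EuclideanSpace ℝ (Fin d) => u i)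
      (cond volume B) (Measure.pi fun _ : Fin m => cond volume B) := fun i =>
    ⟨(measurable_pi_apply i).aemeasurable, (measurePreserving_eval _ i).map_eq⟩
  obtain ⟨h1, h2⟩ := integral_shortestPath_of_iIndepFun hp hind hlaw
    (Fin.castLE_injective hnm) x y
  simp only
  rw [← h2]
  exact integral_mono (integrable_shortestPath
    (measurable_shortestPath_range hp m x y).aemeasurable) h1
    fun u => shortestPath_anti (by rintro _ ⟨i, rfl⟩; exact ⟨_, rfl⟩) x y

theorem integrable_sampleMean (hp : 0 < p) {B : Set (EuclideanSpace ℝ (Fin d))}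
    [IsProbabilityMeasure (cond volume B)] (μ : Measure ℕ) [IsFiniteMeasure μ]
    (x y : EuclideanSpace ℝ (Fin d)) : Integrable (fun n => sampleMean p B n x y) μ :=
  Integrable.of_bound Measurable.of_discrete.aestronglyMeasurable (dist x y ^ p)
    (ae_of_all _ fun n => by
      rw [Real.norm_of_nonneg (sampleMean_nonneg _ _ _ _ _)]
      exact sampleMean_le hp n x y)

/-- The mean for the Poisson process is a mixture of the means for samples of fixed size. -/
theorem meanPath_eq_integral_sampleMean (hp : 0 < p) (lam : ℝ≥0)
    {B : Set (EuclideanSpace ℝ (Fin d))} [IsProbabilityMeasure (cond volume B)]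
    (x y : EuclideanSpace ℝ (Fin d)) :
    meanPath p lam B x y =
      ∫ n, sampleMean p B n x y ∂poissonMeasure (lam * (volume B).toNNReal) := by
  have hL := measurable_shortestPath (E := EuclideanSpace ℝ (Fin d)) hp x y
  rw [meanPath, integral_eq_lintegral_of_nonneg_ae
    (ae_of_all _ fun _ => shortestPath_nonneg _ _ _ _) hL.aestronglyMeasurable,
    integral_eq_lintegral_of_nonneg_ae
    (ae_of_all _ fun _ => sampleMean_nonneg _ _ _ _ _) Measurable.of_discrete.aestronglyMeasurable,
    poissonLaw, Measure.lintegral_bind (aemeasurable_poissonKernel _)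
      hL.ennreal_ofReal.aemeasurable]
  congr 2
  funext n
  rw [lintegral_map hL.ennreal_ofReal (PointSet.measurable_range n), sampleMean,
    ofReal_integral_eq_lintegral_ofReal (integrable_shortestPath
      (measurable_shortestPath_range hp n x y).aemeasurable)
      (ae_of_all _ fun _ => shortestPath_nonneg _ _ _ _)]

theorem integral_pow_poissonMeasure (r : ℝ≥0) (θ : ℝ) :
    Integrable (fun n : ℕ => θ ^ n) (poissonMeasure r) ∧
      ∫ n : ℕ, θ ^ n ∂poissonMeasure r = Real.exp (r * (θ - 1)) := by
  constructor
  · rw [integrable_poissonMeasure_iff]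
    refine ((Real.summable_pow_div_factorial (r * |θ|)).mul_left (Real.exp (-r))).congr fun n => ?_
    rw [norm_pow, Real.norm_eq_abs, mul_pow]
    ring
  · rw [integral_poissonMeasure]
    have h : ∀ n : ℕ, (Real.exp (-r) * r ^ n / n.factorial) • θ ^ n =
        Real.exp (-r) * ((r * θ) ^ n / n.factorial) := fun n => by
      rw [smul_eq_mul, mul_pow]; ring
    simp_rw [h]
    rw [tsum_mul_left, ← congrFun (NormedSpace.exp_eq_tsum_div (𝔸 := ℝ)) (r * θ),
      ← Real.exp_eq_exp_ℝ, ← Real.exp_add]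
    ring_nf

/-- Chernoff bound for the Poisson distribution of mean `κ * n`. -/
theorem poissonMeasure_real_le {κ : ℝ} (hκ : 0 < κ) {n : ℕ} {r : ℝ≥0} (hr : (r : ℝ) = κ * n)
    {S : Set ℕ} (hS : ∀ k ∈ S, κ ^ k ≤ κ ^ n) :
    (poissonMeasure r).real S ≤ Real.exp (-(κ - 1 - Real.log κ)) ^ n := by
  obtain ⟨h1, h2⟩ := integral_pow_poissonMeasure r κ⁻¹
  -- Exponential Markov inequality: on `S` the weight `κ ^ n * κ⁻¹ ^ k` is at least 1.
  have h3 : (poissonMeasure r).real S ≤ ∫ k : ℕ, κ ^ n * κ⁻¹ ^ k ∂poissonMeasure r := by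
    rw [← integral_indicator_one (μ := poissonMeasure r) (MeasurableSet.of_discrete (s := S))]
    refine integral_mono ((integrable_const 1).indicator MeasurableSet.of_discrete)
      (h1.const_mul _) fun k => ?_
    by_cases hk : k ∈ S
    · simp only [Set.indicator_of_mem hk, Pi.one_apply]
      rw [inv_pow, ← div_eq_mul_inv, one_le_div (by positivity)]
      exact hS k hk
    · simp only [Set.indicator_of_notMem hk]
      positivity
  refine h3.trans_eq ?_
  rw [integral_const_mul, h2, hr, ← Real.exp_nat_mul]
  nth_rewrite 1 [← Real.exp_log hκ]
  rw [← Real.exp_nat_mul, ← Real.exp_add]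
  congr 1
  field_simp
  ring

/-- For `κ < 1` a Poisson count is mostly at most `n`, and then monotonicity in the number of points
applies; the direct edge pays for the exponentially unlikely excess. -/
theorem sampleMean_le_meanPath_add (hp : 0 < p) {lam : ℝ≥0}
    {B : Set (EuclideanSpace ℝ (Fin d))} [IsProbabilityMeasure (cond volume B)]
    (x y : EuclideanSpace ℝ (Fin d)) {κ : ℝ} (hκ : 0 < κ) (hκ1 : κ < 1) {n : ℕ}
    (hn : ((lam * (volume B).toNNReal : ℝ≥0) : ℝ) = κ * n) :
    sampleMean p B n x y ≤ meanPath p lam B x y +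
      dist x y ^ p * Real.exp (-(κ - 1 - Real.log κ)) ^ n := by
  have hD : 0 ≤ dist x y ^ p := Real.rpow_nonneg dist_nonneg _
  rw [meanPath_eq_integral_sampleMean hp]
  set π := poissonMeasure (lam * (volume B).toNNReal)
  have hb := poissonMeasure_real_le hκ hn (S := Set.Ioi n) fun k hk =>
    pow_le_pow_of_le_one hκ.le hκ1.le (Set.mem_Ioi.1 hk).le
  have hint := integrable_sampleMean hp (B := B) π x y
  have hint2 : Integrable ((Set.Ioi n).indicator fun _ => dist x y ^ p) π :=
    (integrable_const _).indicator MeasurableSet.of_discrete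
  have h := integral_mono (μ := π) (integrable_const (sampleMean p B n x y)) (hint.add hint2)
    fun k => by
      simp only [Pi.add_apply]
      by_cases hk : k ∈ Set.Ioi n
      · rw [Set.indicator_of_mem hk]
        linarith [sampleMean_le hp (B := B) n x y, sampleMean_nonneg p B k x y]
      · rw [Set.indicator_of_notMem hk, add_zero]
        exact antitone_sampleMean hp x y (not_lt.1 hk)
  rw [integral_add' hint hint2, integral_indicator_const _ MeasurableSet.of_discrete,
    integral_const, probReal_univ, one_smul, smul_eq_mul, mul_comm (π.real _)] at h
  exact h.trans (by gcongr)

/-- The mirror case: for `κ > 1` a count below `n` is exponentially unlikely. -/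
theorem meanPath_le_sampleMean_add (hp : 0 < p) {lam : ℝ≥0}
    {B : Set (EuclideanSpace ℝ (Fin d))} [IsProbabilityMeasure (cond volume B)]
    (x y : EuclideanSpace ℝ (Fin d)) {κ : ℝ} (hκ1 : 1 < κ) {n : ℕ}
    (hn : ((lam * (volume B).toNNReal : ℝ≥0) : ℝ) = κ * n) :
    meanPath p lam B x y ≤ sampleMean p B n x y +
      dist x y ^ p * Real.exp (-(κ - 1 - Real.log κ)) ^ n := by
  have hD : 0 ≤ dist x y ^ p := Real.rpow_nonneg dist_nonneg _
  rw [meanPath_eq_integral_sampleMean hp]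
  set π := poissonMeasure (lam * (volume B).toNNReal)
  have hb := poissonMeasure_real_le (by linarith) hn (S := Set.Iio n) fun k hk =>
    pow_le_pow_right₀ hκ1.le (Set.mem_Iio.1 hk).le
  have hint := integrable_sampleMean hp (B := B) π x y
  have hint2 : Integrable ((Set.Iio n).indicator fun _ => dist x y ^ p) π :=
    (integrable_const _).indicator MeasurableSet.of_discrete
  have h := integral_mono (μ := π) hint ((integrable_const (sampleMean p B n x y)).add hint2)
    fun k => by
      simp only [Pi.add_apply]
      by_cases hk : k ∈ Set.Iio n
      · rw [Set.indicator_of_mem hk]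
        linarith [sampleMean_le hp (B := B) k x y, sampleMean_nonneg p B n x y]
      · rw [Set.indicator_of_notMem hk, add_zero]
        exact antitone_sampleMean hp x y (not_lt.1 hk)
  rw [integral_add' (integrable_const _) hint2,
    integral_indicator_const _ MeasurableSet.of_discrete,
    integral_const, probReal_univ, one_smul, smul_eq_mul, mul_comm (π.real _)] at h
  exact h.trans (by gcongr)

theorem measureReal_ball_pos (z : EuclideanSpace ℝ (Fin d)) {R : ℝ} (hR : 0 < R) :
    0 < volume.real (Metric.ball z R) :=
  ENNReal.toReal_pos (Metric.measure_ball_pos _ _ hR).ne' measure_ball_lt_top.ne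

theorem withDensity_uniformDensity (z : EuclideanSpace ℝ (Fin d)) {R : ℝ} (hR : 0 < R) :
    (volume.withDensity fun u => ENNReal.ofReal (uniformDensity z R u)) =
      cond volume (Metric.ball z R) := by
  have h : (fun u => ENNReal.ofReal (uniformDensity z R u)) =
      (Metric.ball z R).indicator fun _ => (volume (Metric.ball z R))⁻¹ := by
    funext u
    by_cases hu : u ∈ Metric.ball z R
    · simp only [uniformDensity, Set.indicator_of_mem hu]
      rw [ENNReal.ofReal_inv_of_pos (measureReal_ball_pos z hR), ofReal_measureReal measure_ball_lt_top.ne]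
    · simp [uniformDensity, Set.indicator_of_notMem hu]
  rw [h, withDensity_indicator measurableSet_ball, withDensity_const]
  rfl

end Sample

/-! ### Passage from the constant to uniform samples in a ball. -/

section MeanConvergence

variable {d : ℕ} {p : ℝ}

theorem meanPath_eq_rpow_mul (hd : d ≠ 0) (hp : 0 < p) {a : ℝ} (ha : 0 < a)
    (x y z : EuclideanSpace ℝ (Fin d)) (R : ℝ) :
    meanPath p a.toNNReal (Metric.ball z R) x y = (a ^ (d : ℝ)⁻¹) ^ (-p) *
      meanPath p 1 (Metric.ball (a ^ (d : ℝ)⁻¹ • z) (a ^ (d : ℝ)⁻¹ * R))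
        (a ^ (d : ℝ)⁻¹ • x) (a ^ (d : ℝ)⁻¹ • y) := by
  set ρ := a ^ (d : ℝ)⁻¹ with hρ
  have hρ0 : 0 < ρ := Real.rpow_pos_of_pos ha _
  have hρd : ρ ^ d = a := Real.rpow_inv_natCast_pow ha.le hd
  have h := meanPath_smul hp 1 (B := Metric.ball z R) measurableSet_ball
    measure_ball_lt_top.ne (r := ρ.toNNReal) (Real.toNNReal_pos.2 hρ0) x y
  have hball : (fun w => (ρ.toNNReal : ℝ) • w) '' Metric.ball z R =
      Metric.ball (ρ • z) (ρ * R) := by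
    rw [Real.coe_toNNReal _ hρ0.le]
    have := smul_ball hρ0.ne' z R
    rw [Real.norm_of_nonneg hρ0.le] at this
    exact this
  rw [hball, Real.coe_toNNReal _ hρ0.le, one_mul, ← Real.toNNReal_pow hρ0.le, hρd] at h
  rw [h, ← mul_assoc, ← Real.rpow_add hρ0]
  simp

/-- The lower bound is that of the whole space. For the upper bound, convexity keeps the segment in
the ball of radius `ρ n * R₁`, so its distance from the boundary is at least `ρ n * (R₂ - R₁)`,
which grows in proportion to `ρ n`. -/
theorem tendsto_meanPath_dilation (hd : d ≠ 0) (hp : 1 < p) {e : EuclideanSpace ℝ (Fin d)}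
    (he : ‖e‖ = 1) {L : ℝ} (hL : 0 ≤ L)
    (hlim : Tendsto (fun t => radialMean p e t / t) atTop (𝓝 L))
    {z : EuclideanSpace ℝ (Fin d)} {R₁ R₂ : ℝ} (hR₁ : 0 < R₁) (hR : R₁ < R₂)
    {x y : ℕ → EuclideanSpace ℝ (Fin d)} (hx : ∀ n, x n ∈ Metric.ball z R₁)
    (hy : ∀ n, y n ∈ Metric.ball z R₁) {ρ : ℕ → ℝ} (hρ : Tendsto ρ atTop atTop)
    (hρxy : Tendsto (fun n => ρ n * dist (x n) (y n)) atTop atTop) :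
    Tendsto (fun n => meanPath p 1 (Metric.ball (ρ n • z) (ρ n * R₂)) (ρ n • x n) (ρ n • y n) /
      (ρ n * dist (x n) (y n))) atTop (𝓝 L) := by
  have hp0 : 0 < p := by linarith
  have hdist : ∀ n, 0 < ρ n → dist (ρ n • x n) (ρ n • y n) = ρ n * dist (x n) (y n) :=
    fun n hn => by rw [dist_smul₀, Real.norm_of_nonneg hn.le]
  refine tendsto_order.2 ⟨fun a ha => ?_, fun a ha => ?_⟩
  · filter_upwards [(hlim.comp hρxy).eventually_const_lt ha, hρ.eventually_gt_atTop 0,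
      hρxy.eventually_gt_atTop 0] with n hn hn0 hn1
    refine hn.trans_le ?_
    simp only [Function.comp]
    rw [← hdist n hn0] at hn1 ⊢
    exact div_le_div_of_nonneg_right
      (radialMean_le_meanPath hp0 he measurableSet_ball Metric.isBounded_ball _ _) hn1.le
  -- The clearance divided by the bound `2 * R₁` on the distance of the ends.
  · set c := (R₂ - R₁) / (2 * R₁) with hc
    have hc0 : 0 < c := div_pos (by linarith) (by linarith)
    obtain ⟨R, t₀, h⟩ := exists_meanPath_le_of_tendsto hd hp he hL hlim hc0
      (by linarith : 0 < (a - L) / 2)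
    filter_upwards [hρ.eventually_gt_atTop 0, hρxy.eventually_gt_atTop 0,
      hρxy.eventually_ge_atTop t₀, hρ.eventually_ge_atTop (R / (R₂ - R₁))]
      with n hn0 hn1 hn2 hn3
    rw [← hdist n hn0] at hn1 hn2 ⊢
    have h2 := h (Metric.ball (ρ n • z) (ρ n * R₂)) (ρ n • x n) (ρ n • y n) measurableSet_ball
      measure_ball_lt_top.ne hn2 fun w hw => ?_
    · rw [div_lt_iff₀ hn1]
      refine h2.trans_lt ?_
      gcongr
      linarith
    · have hmem : ∀ v ∈ Metric.ball z R₁, ρ n • v ∈ Metric.ball (ρ n • z) (ρ n * R₁) :=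
        fun v hv => by
          rw [Metric.mem_ball, dist_smul₀, Real.norm_of_nonneg hn0.le]
          exact mul_lt_mul_of_pos_left hv hn0
      have hw' : dist w (ρ n • z) < ρ n * R₁ :=
        (convex_ball (ρ n • z) (ρ n * R₁)).segment_subset (hmem _ (hx n)) (hmem _ (hy n)) hw
      rw [div_le_iff₀ (by linarith)] at hn3
      have hxy : dist (x n) (y n) ≤ 2 * R₁ := by
        have h3 : dist (x n) z < R₁ := hx n
        have h4 : dist (y n) z < R₁ := hy n
        linarith [dist_triangle_right (x n) (y n) z]
      have h5 : c * (ρ n * dist (x n) (y n)) ≤ ρ n * (R₂ - R₁) := by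
        calc c * (ρ n * dist (x n) (y n)) ≤ c * (ρ n * (2 * R₁)) := by gcongr
          _ = ρ n * (R₂ - R₁) := by rw [hc]; field_simp
      rw [hdist n hn0]
      constructor <;> refine Metric.ball_subset_ball' ?_ <;> linarith

/-- Dilation by `ρ n` to unit intensity gives a mean of order `ρ n ^ (-p) * (ρ n * dist)`; the power
`ρ n ^ (1 - p)` splits off `κ ^ ((1 - p) / d)`. -/
theorem tendsto_meanPath_div (hd : d ≠ 0) (hp : 1 < p) {e : EuclideanSpace ℝ (Fin d)}
    (he : ‖e‖ = 1) {L : ℝ} (hL : 0 ≤ L)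
    (hlim : Tendsto (fun t => radialMean p e t / t) atTop (𝓝 L))
    {z : EuclideanSpace ℝ (Fin d)} {R₁ R₂ : ℝ} (hR₁ : 0 < R₁) (hR : R₁ < R₂)
    {x y : ℕ → EuclideanSpace ℝ (Fin d)} (hx : ∀ n, x n ∈ Metric.ball z R₁)
    (hy : ∀ n, y n ∈ Metric.ball z R₁) {V : ℝ} (hV : 0 < V)
    (hxy : Tendsto (fun n : ℕ => ((n : ℝ) * V⁻¹) ^ (d : ℝ)⁻¹ * dist (x n) (y n)) atTop atTop)
    {κ : ℝ} (hκ : 0 < κ) :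
    Tendsto (fun n : ℕ => meanPath p (κ * (n * V⁻¹)).toNNReal (Metric.ball z R₂) (x n) (y n) /
      (((n : ℝ) * V⁻¹) ^ ((1 - p) / (d : ℝ)) * dist (x n) (y n))) atTop
      (𝓝 (κ ^ ((1 - p) / (d : ℝ)) * L)) := by
  have hp0 : 0 < p := by linarith
  have hd0 : (0 : ℝ) < d := by exact_mod_cast Nat.pos_of_ne_zero hd
  have hlam : Tendsto (fun n : ℕ => (n : ℝ) * V⁻¹) atTop atTop :=
    tendsto_natCast_atTop_atTop.atTop_mul_const (inv_pos.2 hV)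
  set ρ : ℕ → ℝ := fun n => (κ * (n * V⁻¹)) ^ (d : ℝ)⁻¹ with hρ
  have hρlim : Tendsto ρ atTop atTop :=
    (tendsto_rpow_atTop (inv_pos.2 hd0)).comp (hlam.const_mul_atTop hκ)
  have hρxy : Tendsto (fun n => ρ n * dist (x n) (y n)) atTop atTop := by
    refine (hxy.const_mul_atTop (Real.rpow_pos_of_pos hκ (d : ℝ)⁻¹)).congr fun n => ?_
    simp only [hρ]
    rw [Real.mul_rpow hκ.le (by positivity), mul_assoc]
  refine ((tendsto_meanPath_dilation hd hp he hL hlim hR₁ hR hx hy hρlim hρxy).const_mul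
    (κ ^ ((1 - p) / (d : ℝ)))).congr' ?_
  filter_upwards [hlam.eventually_gt_atTop 0, hρxy.eventually_gt_atTop 0] with n hn hn1
  have ha : 0 < κ * (n * V⁻¹) := by positivity
  rw [meanPath_eq_rpow_mul hd hp0 ha]
  change _ = ρ n ^ (-p) * _ / _
  have hρn : 0 < ρ n := Real.rpow_pos_of_pos ha _
  have hr : 0 < dist (x n) (y n) := pos_of_mul_pos_right hn1 hρn.le
  have h1 : κ ^ ((1 - p) / (d : ℝ)) * (n * V⁻¹) ^ ((1 - p) / (d : ℝ)) = ρ n * ρ n ^ (-p) := by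
    rw [← Real.mul_rpow hκ.le hn.le]
    nth_rewrite 1 [← Real.rpow_one (ρ n)]
    rw [← Real.rpow_add hρn, ← Real.rpow_mul ha.le]
    congr 1
    ring
  have h2 : 0 < ((n : ℝ) * V⁻¹) ^ ((1 - p) / (d : ℝ)) := Real.rpow_pos_of_pos hn _
  rw [← mul_div_assoc, div_eq_div_iff hn1.ne' (by positivity)]
  linear_combination (meanPath p 1 (Metric.ball (ρ n • z) (ρ n * R₂)) (ρ n • x n) (ρ n • y n) *
    dist (x n) (y n)) * h1

/-- Mean convergence of the path length for independent uniform samples. -/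
theorem tendsto_sampleMean_div (hd : d ≠ 0) (hp : 1 < p) {e : EuclideanSpace ℝ (Fin d)}
    (he : ‖e‖ = 1) {L : ℝ} (hL : 0 ≤ L)
    (hlim : Tendsto (fun t => radialMean p e t / t) atTop (𝓝 L))
    {z : EuclideanSpace ℝ (Fin d)} {R₁ R₂ : ℝ} (hR₁ : 0 < R₁) (hR : R₁ < R₂)
    {x y : ℕ → EuclideanSpace ℝ (Fin d)} (hx : ∀ n, x n ∈ Metric.ball z R₁)
    (hy : ∀ n, y n ∈ Metric.ball z R₁) {V : ℝ} (hV : V = volume.real (Metric.ball z R₂))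
    (hxy : Tendsto (fun n : ℕ => ((n : ℝ) * V⁻¹) ^ (d : ℝ)⁻¹ * dist (x n) (y n)) atTop atTop) :
    Tendsto (fun n : ℕ => sampleMean p (Metric.ball z R₂) n (x n) (y n) /
      (((n : ℝ) * V⁻¹) ^ ((1 - p) / (d : ℝ)) * dist (x n) (y n))) atTop (𝓝 L) := by
  have hp0 : 0 < p := by linarith
  have hd0 : (0 : ℝ) < d := by exact_mod_cast Nat.pos_of_ne_zero hd
  have hV0 : 0 < V := hV ▸ measureReal_ball_pos z (hR₁.trans hR)
  have hprob : IsProbabilityMeasure (cond volume (Metric.ball z R₂)) :=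
    cond_isProbabilityMeasure_of_finite (Metric.measure_ball_pos _ _ (hR₁.trans hR)).ne'
      measure_ball_lt_top.ne
  have hmean := fun (κ : ℝ) (hκ : 0 < κ) =>
    tendsto_meanPath_div hd hp he hL hlim hR₁ hR hx hy hV0 hxy hκ
  have hlam : Tendsto (fun n : ℕ => (n : ℝ) * V⁻¹) atTop atTop :=
    tendsto_natCast_atTop_atTop.atTop_mul_const (inv_pos.2 hV0)
  have hcount : ∀ (κ : ℝ) (_ : 0 < κ) (n : ℕ),
      (((κ * (n * V⁻¹)).toNNReal * (volume (Metric.ball z R₂)).toNNReal : ℝ≥0) : ℝ) = κ * n :=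
    fun κ hκ n => by
      push_cast
      rw [Real.coe_toNNReal _ (by positivity)]
      change _ * volume.real (Metric.ball z R₂) = _
      rw [← hV]
      field_simp
  -- One power of the distance cancels and the remaining `p - 1` are bounded, leaving a power of `n`
  -- against exponential decay.
  have herr : ∀ κ : ℝ, 0 < κ → κ ≠ 1 → Tendsto (fun n : ℕ =>
      dist (x n) (y n) ^ p * Real.exp (-(κ - 1 - Real.log κ)) ^ n /
        (((n : ℝ) * V⁻¹) ^ ((1 - p) / (d : ℝ)) * dist (x n) (y n))) atTop (𝓝 0) := by
    intro κ hκ hκ1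
    have hc : 0 < κ - 1 - Real.log κ := by linarith [Real.log_lt_sub_one_of_pos hκ hκ1]
    have h1 := ((tendsto_rpow_mul_exp_neg_mul_atTop_nhds_zero ((p - 1) / (d : ℝ)) _ hc).comp
      tendsto_natCast_atTop_atTop).const_mul ((2 * R₁) ^ (p - 1) * V⁻¹ ^ ((p - 1) / (d : ℝ)))
    rw [mul_zero] at h1
    refine squeeze_zero' (Eventually.of_forall fun n => by positivity) ?_ h1
    filter_upwards [hlam.eventually_gt_atTop 0, hxy.eventually_gt_atTop 0] with n hn hn1
    have hr : 0 < dist (x n) (y n) := pos_of_mul_pos_right hn1 (Real.rpow_nonneg hn.le _)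
    have hr' : dist (x n) (y n) ≤ 2 * R₁ := by
      have h3 : dist (x n) z < R₁ := hx n
      have h4 : dist (y n) z < R₁ := hy n
      linarith [dist_triangle_right (x n) (y n) z]
    have h2 : ((n : ℝ) * V⁻¹) ^ ((1 - p) / (d : ℝ)) =
        (((n : ℝ) * V⁻¹) ^ ((p - 1) / (d : ℝ)))⁻¹ := by
      rw [← Real.rpow_neg hn.le]; congr 1; ring
    have h3 : dist (x n) (y n) ^ p = dist (x n) (y n) ^ (p - 1) * dist (x n) (y n) := by
      rw [Real.rpow_sub_one hr.ne', div_mul_cancel₀ _ hr.ne']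
    have h4 : 0 < ((n : ℝ) * V⁻¹) ^ ((p - 1) / (d : ℝ)) := Real.rpow_pos_of_pos hn _
    simp only [Function.comp]
    rw [h2, h3, ← Real.exp_nat_mul]
    calc dist (x n) (y n) ^ (p - 1) * dist (x n) (y n) *
          Real.exp (n * -(κ - 1 - Real.log κ)) /
          ((((n : ℝ) * V⁻¹) ^ ((p - 1) / (d : ℝ)))⁻¹ * dist (x n) (y n))
        = dist (x n) (y n) ^ (p - 1) * (((n : ℝ) * V⁻¹) ^ ((p - 1) / (d : ℝ)) *
          Real.exp (n * -(κ - 1 - Real.log κ))) := by field_simp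
      _ ≤ (2 * R₁) ^ (p - 1) * (((n : ℝ) * V⁻¹) ^ ((p - 1) / (d : ℝ)) *
          Real.exp (n * -(κ - 1 - Real.log κ))) := by
          gcongr
      _ = _ := by
          rw [Real.mul_rpow n.cast_nonneg (inv_nonneg.2 hV0.le), mul_comm (n : ℝ) (-_)]
          ring
  have hcont : Tendsto (fun κ : ℝ => κ ^ ((1 - p) / (d : ℝ)) * L) (𝓝 1) (𝓝 L) := by
    have : ContinuousAt (fun κ : ℝ => κ ^ ((1 - p) / (d : ℝ)) * L) 1 :=
      (Real.continuousAt_rpow_const _ _ (Or.inl one_ne_zero)).mul continuousAt_const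
    simpa [ContinuousAt] using this
  refine tendsto_order.2 ⟨fun a ha => ?_, fun a ha => ?_⟩
  -- `κ` is fixed close enough to 1 for the given `a` before `n` tends to infinity.
  · obtain ⟨κ, hκa, hκ1⟩ := (((hcont.eventually_const_lt ha).filter_mono
      nhdsWithin_le_nhds).and (self_mem_nhdsWithin : Set.Ioi (1 : ℝ) ∈ 𝓝[>] 1)).exists
    have hκ1' : 1 < κ := hκ1
    have h := (hmean κ (by linarith)).sub (herr κ (by linarith) hκ1'.ne')
    rw [sub_zero] at h
    filter_upwards [h.eventually_const_lt hκa] with n hn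
    refine hn.trans_le ?_
    rw [← sub_div]
    refine div_le_div_of_nonneg_right ?_ (by positivity)
    linarith [meanPath_le_sampleMean_add hp0 (x n) (y n) hκ1' (hcount κ (by linarith) n)]
  · obtain ⟨κ, ⟨hκa, hκ0⟩, hκ1⟩ := ((((hcont.eventually_lt_const ha).and
      (eventually_gt_nhds one_pos)).filter_mono
      nhdsWithin_le_nhds).and (self_mem_nhdsWithin : Set.Iio (1 : ℝ) ∈ 𝓝[<] 1)).exists
    have hκ1' : κ < 1 := hκ1
    have h := (hmean κ hκ0).add (herr κ hκ0 hκ1'.ne)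
    rw [add_zero] at h
    filter_upwards [h.eventually_lt_const hκa] with n hn
    refine lt_of_le_of_lt ?_ hn
    rw [← add_div]
    refine div_le_div_of_nonneg_right ?_ (by positivity)
    exact sampleMean_le_meanPath_add hp0 (x n) (y n) hκ0 hκ1' (hcount κ hκ0 n)

end MeanConvergence

/-! ### Sums over all paths through independent points. -/

section ChainWeight

variable {E ι : Type*} [MeasurableSpace E]

/-- The product of the weights `h` of the edges of the path `x → u i₁ → u i₂ → ⋯`. -/
noncomputable def chainWeight (h : E → E → ℝ≥0∞) : E → List ι → (ι → E) → ℝ≥0∞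
  | _, [], _ => 1
  | x, i :: σ, u => h x (u i) * chainWeight h (u i) σ u

theorem measurable_chainWeight {h : E → E → ℝ≥0∞} (hh : Measurable (Function.uncurry h))
    (σ : List ι) : Measurable fun q : E × (ι → E) => chainWeight h q.1 σ q.2 := by
  induction σ with
  | nil => exact measurable_const
  | cons i σ ih =>
    have hi : Measurable fun q : E × (ι → E) => q.2 i := (measurable_pi_apply i).comp measurable_snd
    exact (hh.comp (measurable_fst.prodMk hi)).mul (ih.comp (hi.prodMk measurable_snd))

theorem measurable_chainWeight_right {h : E → E → ℝ≥0∞} (hh : Measurable (Function.uncurry h))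
    (x : E) (σ : List ι) : Measurable (chainWeight h x σ) :=
  (measurable_chainWeight hh σ).comp measurable_prodMk_left

/-- Nodes are integrated out from the end of the path backwards, each edge giving at most `c`.
Absence of repetitions keeps `u i` fixed while the later nodes are integrated. -/
theorem lmarginal_chainWeight_le [DecidableEq ι] {h : E → E → ℝ≥0∞}
    (hh : Measurable (Function.uncurry h)) (μ : Measure E) [IsProbabilityMeasure μ] {c : ℝ≥0∞}
    (hc : ∀ x, ∫⁻ w, h x w ∂μ ≤ c) {σ : List ι} (hσ : σ.Nodup) (x : E) (u : ι → E) :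
    (∫⋯∫⁻_σ.toFinset, chainWeight h x σ ∂fun _ => μ) u ≤ c ^ σ.length := by
  induction σ generalizing x u with
  | nil => simp [chainWeight]
  | cons i σ ih =>
    obtain ⟨hi, hσ'⟩ := List.nodup_cons.1 hσ
    have hi' : i ∉ σ.toFinset := by simpa using hi
    rw [List.toFinset_cons, lmarginal_insert _ (measurable_chainWeight_right hh x _) hi']
    have hinner : ∀ w, (∫⋯∫⁻_σ.toFinset, chainWeight h x (i :: σ) ∂fun _ => μ)
        (Function.update u i w) ≤ h x w * c ^ σ.length := fun w => by
      have h1 : ∀ v : (j : σ.toFinset) → E, chainWeight h x (i :: σ)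
          (Function.updateFinset (Function.update u i w) σ.toFinset v) =
          h x w * chainWeight h w σ
            (Function.updateFinset (Function.update u i w) σ.toFinset v) := fun v => by
        have : Function.updateFinset (Function.update u i w) σ.toFinset v i = w := by
          simp [Function.updateFinset, hi]
        rw [chainWeight, this]
      rw [lmarginal]
      simp_rw [h1]
      have hm : Measurable fun v : (j : σ.toFinset) → E => chainWeight h w σ
          (Function.updateFinset (Function.update u i w) σ.toFinset v) :=
        (measurable_chainWeight_right hh w σ).comp measurable_updateFinset
      rw [lintegral_const_mul _ hm]
      gcongr
      exact ih hσ' w _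
    calc ∫⁻ w, (∫⋯∫⁻_σ.toFinset, chainWeight h x (i :: σ) ∂fun _ => μ) (Function.update u i w) ∂μ
        ≤ ∫⁻ w, h x w * c ^ σ.length ∂μ := lintegral_mono hinner
      _ = (∫⁻ w, h x w ∂μ) * c ^ σ.length :=
          lintegral_mul_const _ (hh.comp measurable_prodMk_left)
      _ ≤ c * c ^ σ.length := by gcongr; exact hc x
      _ = c ^ (i :: σ).length := by rw [List.length_cons, pow_succ']

theorem lintegral_chainWeight_le [Fintype ι] {h : E → E → ℝ≥0∞}
    (hh : Measurable (Function.uncurry h)) (μ : Measure E) [IsProbabilityMeasure μ] {c : ℝ≥0∞}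
    (hc : ∀ x, ∫⁻ w, h x w ∂μ ≤ c) {σ : List ι} (hσ : σ.Nodup) (x : E) :
    ∫⁻ u, chainWeight h x σ u ∂(Measure.pi fun _ : ι => μ) ≤ c ^ σ.length := by
  classical
  refine (lintegral_le_of_lmarginal_le σ.toFinset (g := fun _ => c ^ σ.length)
    (measurable_chainWeight_right hh x σ) measurable_const fun u =>
    (lmarginal_chainWeight_le hh μ hc hσ x u).trans_eq ?_).trans_eq ?_
  · simp [lmarginal]
  · simp

/-- There are `n ^ k` lists of length `k`. -/
theorem tsum_pow_length (n : ℕ) (c : ℝ≥0∞) :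
    ∑' σ : List (Fin n), c ^ σ.length = (1 - n * c)⁻¹ := by
  rw [← List.equivSigmaTuple.symm.tsum_eq, ENNReal.tsum_sigma', ← ENNReal.tsum_geometric]
  refine tsum_congr fun k => ?_
  simp [List.equivSigmaTuple, mul_pow]

end ChainWeight

/-! ### Exponential moments and a linear lower bound. -/

section Positivity

variable {d : ℕ} {p : ℝ}

theorem sub_one_le_rpow (hp : 1 ≤ p) {s : ℝ} (hs : 0 ≤ s) : s - 1 ≤ s ^ p := by
  rcases le_total s 1 with h | h
  · linarith [Real.rpow_nonneg hs p]
  · linarith [Real.self_le_rpow_of_one_le h hp]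

/-- From `s - 1 ≤ s ^ p` at `s = r / θ`: the power cost is replaced by a linear one, to which the
triangle inequality applies. -/
theorem exp_neg_edge_le (hp : 1 ≤ p) {θ r : ℝ} (hθ : 0 < θ) (hr : 0 ≤ r) :
    Real.exp (-(2 * θ ^ (-p) * r ^ p)) ≤ Real.exp (2 - 2 * (r / θ)) := by
  rw [Real.exp_le_exp, Real.rpow_neg hθ.le]
  have h := sub_one_le_rpow hp (div_nonneg hr hθ.le)
  rw [Real.div_rpow hr hθ.le, div_eq_mul_inv (r ^ p)] at h
  linarith

/-- An edge of length `r` has weight at most `exp (2 - 2 * (r / θ))`. Half of this decay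
accumulates, by the triangle inequality, into the factor in `dist x y`; the other half stays as an
integrable edge weight. -/
theorem exp_neg_pathLength_le {E ι : Type*} [MetricSpace E] (hp : 1 ≤ p) {θ : ℝ} (hθ : 0 < θ)
    (u : ι → E) (y : E) (σ : List ι) (x : E) :
    ENNReal.ofReal (Real.exp (-(2 * θ ^ (-p) * pathLength p x (σ.map u) y))) ≤
      ENNReal.ofReal (Real.exp (2 - dist x y / θ)) *
        chainWeight (fun v w => ENNReal.ofReal (Real.exp (2 - dist v w / θ))) x σ u := by
  induction σ generalizing x with
  | nil =>
    simp only [List.map_nil, pathLength, chainWeight, mul_one]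
    refine ENNReal.ofReal_le_ofReal ((exp_neg_edge_le hp hθ dist_nonneg).trans ?_)
    rw [Real.exp_le_exp]
    have : 0 ≤ dist x y / θ := by positivity
    linarith
  | cons i σ ih =>
    simp only [List.map_cons, pathLength, chainWeight]
    rw [mul_add, neg_add, Real.exp_add, ENNReal.ofReal_mul (Real.exp_nonneg _)]
    have h1 : Real.exp (-(2 * θ ^ (-p) * dist x (u i) ^ p)) * Real.exp (2 - dist (u i) y / θ) ≤
        Real.exp (2 - dist x y / θ) * Real.exp (2 - dist x (u i) / θ) := by
      refine (mul_le_mul_of_nonneg_right (exp_neg_edge_le hp hθ dist_nonneg)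
        (Real.exp_nonneg _)).trans ?_
      rw [← Real.exp_add, ← Real.exp_add, Real.exp_le_exp]
      have : dist x y / θ ≤ dist x (u i) / θ + dist (u i) y / θ := by
        rw [← add_div]
        gcongr
        exact dist_triangle _ _ _
      linarith
    have h2 := ENNReal.ofReal_le_ofReal h1
    rw [ENNReal.ofReal_mul (Real.exp_nonneg _), ENNReal.ofReal_mul (Real.exp_nonneg _)] at h2
    calc _ ≤ ENNReal.ofReal (Real.exp (-(2 * θ ^ (-p) * dist x (u i) ^ p))) *
          (ENNReal.ofReal (Real.exp (2 - dist (u i) y / θ)) * chainWeight _ (u i) σ u) := by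
          gcongr; exact ih (u i)
      _ = ENNReal.ofReal (Real.exp (-(2 * θ ^ (-p) * dist x (u i) ^ p))) *
          ENNReal.ofReal (Real.exp (2 - dist (u i) y / θ)) * chainWeight _ (u i) σ u :=
          (mul_assoc _ _ _).symm
      _ ≤ _ := by
          rw [← mul_assoc]
          gcongr

/-- A near-optimal path contributes one term of the sum over repetition-free index lists. The bound
is obtained for each `c` above the infimum, and `c` then decreases to it. -/
theorem exp_neg_shortestPath_le {E ι : Type*} [MetricSpace E] (hp : 1 ≤ p) {θ : ℝ} (hθ : 0 < θ)
    (u : ι → E) (x y : E) :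
    ENNReal.ofReal (Real.exp (-(2 * θ ^ (-p) * shortestPath p (Set.range u) x y))) ≤
      ENNReal.ofReal (Real.exp (2 - dist x y / θ)) * ∑' σ : List ι, {σ : List ι | σ.Nodup}.indicator
        (fun σ => chainWeight (fun v w => ENNReal.ofReal (Real.exp (2 - dist v w / θ))) x σ u)
        σ := by
  set a := 2 * θ ^ (-p) with ha
  have ha0 : 0 < a := by positivity
  set S := shortestPath p (Set.range u) x y
  have hlim : Tendsto (fun c : ℝ => ENNReal.ofReal (Real.exp (-(a * c)))) (𝓝[>] S)
      (𝓝 (ENNReal.ofReal (Real.exp (-(a * S))))) := by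
    have : Continuous fun c : ℝ => ENNReal.ofReal (Real.exp (-(a * c))) :=
      ENNReal.continuous_ofReal.comp (by fun_prop)
    exact (this.tendsto S).mono_left nhdsWithin_le_nhds
  refine le_of_tendsto hlim ?_
  filter_upwards [self_mem_nhdsWithin] with c hc
  obtain ⟨l, hl, hlu, hlc⟩ := exists_path_of_shortestPath_lt (Set.mem_Ioi.1 hc)
  obtain ⟨σ, rfl⟩ : l ∈ Set.range (List.map u) := by
    rw [Set.range_list_map]
    exact hlu
  calc ENNReal.ofReal (Real.exp (-(a * c)))
      ≤ ENNReal.ofReal (Real.exp (-(a * pathLength p x (σ.map u) y))) := by gcongr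
    _ ≤ _ := exp_neg_pathLength_le hp hθ u y σ x
    _ ≤ _ := by
      gcongr
      refine le_trans ?_ (ENNReal.le_tsum σ)
      rw [Set.indicator_of_mem (show σ ∈ {σ : List ι | σ.Nodup} from hl.of_map u)]

theorem integrable_exp_neg_norm (d : ℕ) :
    Integrable fun w : EuclideanSpace ℝ (Fin d) => Real.exp (-‖w‖) := by
  have h1 := (integrable_one_add_norm (E := EuclideanSpace ℝ (Fin d)) (μ := volume)
    (r := ((d + 1 : ℕ) : ℝ)) (by simp)).const_mul (Real.exp 1 * (d + 1).factorial)
  refine h1.mono' (by fun_prop) (ae_of_all _ fun w => ?_)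
  rw [Real.norm_of_nonneg (Real.exp_nonneg _), Real.rpow_neg (by positivity), Real.rpow_natCast,
    ← div_eq_mul_inv, le_div_iff₀ (by positivity)]
  have h2 := Real.pow_div_factorial_le_exp (1 + ‖w‖) (by positivity) (d + 1)
  rw [div_le_iff₀ (by positivity)] at h2
  calc Real.exp (-‖w‖) * (1 + ‖w‖) ^ (d + 1)
      ≤ Real.exp (-‖w‖) * (Real.exp (1 + ‖w‖) * (d + 1).factorial) := by gcongr
    _ = Real.exp 1 * (d + 1).factorial := by
      rw [← mul_assoc, ← Real.exp_add]; congr 2; ring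

theorem lintegral_exp_dist (d : ℕ) {θ : ℝ} (hθ : 0 < θ) (x : EuclideanSpace ℝ (Fin d)) :
    ∫⁻ w, ENNReal.ofReal (Real.exp (2 - dist x w / θ)) = ENNReal.ofReal
      (Real.exp 2 * (θ ^ d * ∫ w : EuclideanSpace ℝ (Fin d), Real.exp (-‖w‖))) := by
  have h : ∀ w, Real.exp (2 - dist x w / θ) = Real.exp 2 * Real.exp (-‖θ⁻¹ • (x - w)‖) :=
    fun w => by
      rw [← Real.exp_add, norm_smul, Real.norm_of_nonneg (inv_nonneg.2 hθ.le), dist_eq_norm]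
      congr 1
      ring
  have hint : Integrable fun w => Real.exp 2 * Real.exp (-‖θ⁻¹ • (x - w)‖) :=
    (((integrable_exp_neg_norm d).comp_smul (inv_pos.2 hθ).ne').comp_sub_left x).const_mul _
  simp_rw [h]
  rw [← ofReal_integral_eq_lintegral_ofReal hint (ae_of_all _ fun w => by positivity),
    integral_const_mul,
    integral_sub_left_eq_self (fun w => Real.exp (-‖θ⁻¹ • w‖)) volume x,
    Measure.integral_comp_smul volume (fun w => Real.exp (-‖w‖)), finrank_euclideanSpace_fin,
    abs_of_nonneg (by positivity), inv_pow, inv_inv, smul_eq_mul]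

/-- Lower bound for the mean path length through independent uniform points. -/
theorem exists_le_sampleMean (hd : d ≠ 0) (hp : 1 < p) :
    ∃ ε : ℝ, 0 < ε ∧ ∀ (B : Set (EuclideanSpace ℝ (Fin d))) (n : ℕ)
      (x y : EuclideanSpace ℝ (Fin d)) (ρ : ℝ), 0 < volume.real B → 0 < ρ →
      ρ ^ d = n * (volume.real B)⁻¹ →
      (dist x y * ρ / ε - 2 * Real.exp 2) * ((ε / ρ) ^ p / 2) ≤ sampleMean p B n x y := by
  set I := ∫ w : EuclideanSpace ℝ (Fin d), Real.exp (-‖w‖) with hI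
  have hI0 : 0 ≤ I := integral_nonneg fun _ => Real.exp_nonneg _
  -- Chosen so that `n * c ≤ 1 / 2` below, which bounds the geometric series over paths by 2.
  set ε := min 1 (1 / (2 * Real.exp 2 * (I + 1))) with hε
  have hε0 : 0 < ε := lt_min one_pos (by positivity)
  have hεI : Real.exp 2 * (ε ^ d * I) ≤ 1 / 2 := by
    calc Real.exp 2 * (ε ^ d * I) ≤ Real.exp 2 * (ε * (I + 1)) := by
          gcongr
          · exact pow_le_of_le_one hε0.le (min_le_left _ _) hd
          · linarith
      _ ≤ Real.exp 2 * (1 / (2 * Real.exp 2 * (I + 1)) * (I + 1)) := by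
          gcongr
          exact min_le_right _ _
      _ = 1 / 2 := by field_simp
  refine ⟨ε, hε0, fun B n x y ρ hV hρ hρd => ?_⟩
  have hp0 : 0 < p := by linarith
  have hB0 : volume B ≠ 0 := fun h => by simp [measureReal_def, h] at hV
  have hBv : volume B ≠ ∞ := fun h => by simp [measureReal_def, h] at hV
  have hprob : IsProbabilityMeasure (cond volume B) := cond_isProbabilityMeasure_of_finite hB0 hBv
  set θ := ε / ρ with hθ
  have hθ0 : 0 < θ := by positivity
  set a := 2 * θ ^ (-p) with ha
  set h : EuclideanSpace ℝ (Fin d) → EuclideanSpace ℝ (Fin d) → ℝ≥0∞ :=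
    fun v w => ENNReal.ofReal (Real.exp (2 - dist v w / θ)) with hh
  have hhm : Measurable (Function.uncurry h) := by
    have : Measurable fun q : EuclideanSpace ℝ (Fin d) × EuclideanSpace ℝ (Fin d) =>
        ENNReal.ofReal (Real.exp (2 - dist q.1 q.2 / θ)) := by fun_prop
    exact this
  set c : ℝ≥0∞ := ENNReal.ofReal ((volume.real B)⁻¹ * (Real.exp 2 * (θ ^ d * I))) with hc
  have hcx : ∀ v, ∫⁻ w, h v w ∂cond volume B ≤ c := fun v => by
    rw [ProbabilityTheory.cond, lintegral_smul_measure, smul_eq_mul, hc, ENNReal.ofReal_mul (by positivity),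
      ← lintegral_exp_dist d hθ0 v, ENNReal.ofReal_inv_of_pos hV, ofReal_measureReal hBv]
    gcongr
    exact Measure.restrict_le_self
  have hnc : n * c ≤ 2⁻¹ := by
    rw [hc, ← ENNReal.ofReal_natCast, ← ENNReal.ofReal_mul (by positivity), ← mul_assoc, ← hρd,
      ← ENNReal.ofReal_ofNat 2, ← ENNReal.ofReal_inv_of_pos two_pos]
    refine ENNReal.ofReal_le_ofReal (le_trans (le_of_eq ?_) (hεI.trans_eq (one_div 2)))
    rw [hθ, div_pow]
    field_simp
  have hinv : (1 - n * c)⁻¹ ≤ 2 := by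
    rw [← inv_inv (2 : ℝ≥0∞), ENNReal.inv_le_inv]
    refine le_trans ?_ (tsub_le_tsub_left hnc 1)
    rw [ENNReal.one_sub_inv_two]
  have hexp : ∫⁻ u, ENNReal.ofReal (Real.exp (-(a * shortestPath p (Set.range u) x y)))
      ∂(Measure.pi fun _ : Fin n => cond volume B) ≤
      ENNReal.ofReal (Real.exp (2 - dist x y / θ) * 2) := by
    refine (lintegral_mono fun u => exp_neg_shortestPath_le hp.le hθ0 u x y).trans ?_
    have hmeas : ∀ σ : List (Fin n), Measurable fun u : Fin n → EuclideanSpace ℝ (Fin d) =>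
        {σ : List (Fin n) | σ.Nodup}.indicator (fun σ => chainWeight h x σ u) σ := fun σ => by
      by_cases hσ : σ ∈ {σ : List (Fin n) | σ.Nodup}
      · simp only [Set.indicator_of_mem hσ]
        exact measurable_chainWeight_right hhm x σ
      · simp only [Set.indicator_of_notMem hσ]
        exact measurable_const
    rw [lintegral_const_mul _ (Measurable.tsum hmeas),
      lintegral_tsum fun σ => (hmeas σ).aemeasurable, ENNReal.ofReal_mul (Real.exp_nonneg _),
      ENNReal.ofReal_ofNat]
    gcongr
    refine le_trans ?_ ((tsum_pow_length n c).le.trans hinv)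
    refine ENNReal.tsum_le_tsum fun σ => ?_
    by_cases hσ : σ ∈ {σ : List (Fin n) | σ.Nodup}
    · simp only [Set.indicator_of_mem hσ]
      exact lintegral_chainWeight_le hhm _ hcx hσ x
    · simp [Set.indicator_of_notMem hσ]
  have hLm := measurable_shortestPath_range (d := d) hp0 n x y
  have hLi : Integrable (fun u : Fin n → EuclideanSpace ℝ (Fin d) =>
      shortestPath p (Set.range u) x y) (Measure.pi fun _ : Fin n => cond volume B) :=
    integrable_shortestPath hLm.aemeasurable
  have ha0 : 0 < a := by positivity
  have hEi : Integrable (fun u : Fin n → EuclideanSpace ℝ (Fin d) =>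
      Real.exp (-(a * shortestPath p (Set.range u) x y)))
      (Measure.pi fun _ : Fin n => cond volume B) :=
    Integrable.of_bound (Real.measurable_exp.comp
      (hLm.const_mul a).neg).aestronglyMeasurable 1 (ae_of_all _ fun u => by
        rw [Real.norm_of_nonneg (Real.exp_nonneg _), Real.exp_le_one_iff, neg_nonpos]
        exact mul_nonneg ha0.le (shortestPath_nonneg _ _ _ _))
  rw [← ofReal_integral_eq_lintegral_ofReal hEi (ae_of_all _ fun _ => Real.exp_nonneg _),
    ENNReal.ofReal_le_ofReal_iff (by positivity)] at hexp
  set s := dist x y / θ with hs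
  -- The tangent line of `exp (-·)` at `s` turns the exponential moment into a bound for the mean.
  have htangent : Real.exp (-s) * (1 + s - a * sampleMean p B n x y) ≤
      ∫ u, Real.exp (-(a * shortestPath p (Set.range u) x y))
        ∂(Measure.pi fun _ : Fin n => cond volume B) := by
    have h1 : Real.exp (-s) * (1 + s - a * sampleMean p B n x y) =
        ∫ u, Real.exp (-s) * (1 + s - a * shortestPath p (Set.range u) x y)
          ∂(Measure.pi fun _ : Fin n => cond volume B) := by
      rw [integral_const_mul, integral_sub (integrable_const _) (hLi.const_mul a),
        integral_const_mul, integral_const, probReal_univ, one_smul]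
      rfl
    rw [h1]
    refine integral_mono (((integrable_const _).sub (hLi.const_mul a)).const_mul _) hEi
      fun u => ?_
    simp only
    have h2 := Real.add_one_le_exp (s - a * shortestPath p (Set.range u) x y)
    calc Real.exp (-s) * (1 + s - a * shortestPath p (Set.range u) x y)
        ≤ Real.exp (-s) * Real.exp (s - a * shortestPath p (Set.range u) x y) := by
          gcongr; linarith
      _ = _ := by rw [← Real.exp_add]; congr 1; ring
  have h3 : Real.exp (-s) * (1 + s - a * sampleMean p B n x y) ≤
      Real.exp (-s) * (2 * Real.exp 2) := by
    refine htangent.trans (hexp.trans_eq ?_)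
    rw [sub_eq_add_neg, Real.exp_add]
    ring
  have h4 := le_of_mul_le_mul_left h3 (Real.exp_pos _)
  have h5 : s = dist x y * ρ / ε := by rw [hs, hθ]; field_simp
  have h6 : a * (θ ^ p / 2) = 1 := by
    rw [ha, Real.rpow_neg hθ0.le]
    field_simp
  rw [← h5]
  calc (s - 2 * Real.exp 2) * (θ ^ p / 2) ≤ (a * sampleMean p B n x y) * (θ ^ p / 2) := by
        gcongr; linarith
    _ = sampleMean p B n x y * (a * (θ ^ p / 2)) := by ring
    _ = _ := by rw [h6, mul_one]

end Positivity

/-! ### Positivity of the constant and the main theorem. -/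

section MainTheorem

variable {d : ℕ} {p : ℝ}

theorem radialMean_eq (hp : 0 < p) {e e' : EuclideanSpace ℝ (Fin d)} (he : ‖e‖ = 1)
    (he' : ‖e'‖ = 1) {t : ℝ} (ht : 0 ≤ t) : radialMean p e' t = radialMean p e t := by
  have hdist : dist 0 (t • e') = t := by
    rw [dist_zero_left, norm_smul, he', mul_one, Real.norm_of_nonneg ht]
  refine iInf_congr fun R => ?_
  rw [meanPath_ball_eq hp 1 he, hdist]

/-- The growth rate of the mean path length is positive. -/
theorem pos_of_tendsto_radialMean_div (hd : d ≠ 0) (hp : 1 < p) {e : EuclideanSpace ℝ (Fin d)}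
    (he : ‖e‖ = 1) {L : ℝ} (hL : 0 ≤ L)
    (hlim : Tendsto (fun t => radialMean p e t / t) atTop (𝓝 L)) : 0 < L := by
  obtain ⟨ε, hε, h⟩ := exists_le_sampleMean (p := p) hd hp
  have hd0 : (0 : ℝ) < d := by exact_mod_cast Nat.pos_of_ne_zero hd
  -- One test case suffices: for fixed ends at distance `1 / 2` the normalised mean tends to `L`,
  -- and its lower bounds tend to `ε ^ (p - 1) / 2`.
  set B := Metric.ball (0 : EuclideanSpace ℝ (Fin d)) 2 with hB
  set V := volume.real B with hV
  have hV0 : 0 < V := measureReal_ball_pos 0 two_pos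
  set y : EuclideanSpace ℝ (Fin d) := (2⁻¹ : ℝ) • e with hy
  have hdist : dist 0 y = 2⁻¹ := by
    rw [dist_zero_left, hy, norm_smul, he, mul_one, Real.norm_of_nonneg (by norm_num)]
  have hlam : Tendsto (fun n : ℕ => (n : ℝ) * V⁻¹) atTop atTop :=
    tendsto_natCast_atTop_atTop.atTop_mul_const (inv_pos.2 hV0)
  have hρ : Tendsto (fun n : ℕ => ((n : ℝ) * V⁻¹) ^ (d : ℝ)⁻¹) atTop atTop :=
    (tendsto_rpow_atTop (inv_pos.2 hd0)).comp hlam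
  have h1 := tendsto_sampleMean_div hd hp he hL hlim (z := 0) (R₁ := 1) (R₂ := 2)
    (x := fun _ => 0) (y := fun _ => y) one_pos one_lt_two (fun _ => by simp)
    (fun _ => by rw [Metric.mem_ball, dist_comm, hdist]; norm_num) hV
    (by simp only [hdist]; exact hρ.atTop_mul_const (by norm_num))
  have h2 : Tendsto (fun n : ℕ => ε ^ (p - 1) / 2 -
      2 * Real.exp 2 * ε ^ p * (((n : ℝ) * V⁻¹) ^ (d : ℝ)⁻¹)⁻¹) atTop
      (𝓝 (ε ^ (p - 1) / 2 - 2 * Real.exp 2 * ε ^ p * 0)) :=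
    tendsto_const_nhds.sub (hρ.inv_tendsto_atTop.const_mul _)
  rw [mul_zero, sub_zero] at h2
  have hpos : 0 < ε ^ (p - 1) / 2 := by positivity
  refine hpos.trans_le (le_of_tendsto_of_tendsto h2 h1 ?_)
  filter_upwards [hlam.eventually_gt_atTop 0] with n hn
  set ρ := ((n : ℝ) * V⁻¹) ^ (d : ℝ)⁻¹ with hρdef
  have hρ0 : 0 < ρ := Real.rpow_pos_of_pos hn _
  have h3 := h B n 0 y ρ hV0 hρ0 (Real.rpow_inv_natCast_pow hn.le hd)
  have h4 : ((n : ℝ) * V⁻¹) ^ ((1 - p) / (d : ℝ)) = ρ * (ρ ^ p)⁻¹ := by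
    rw [← Real.rpow_neg hρ0.le]
    nth_rewrite 1 [← Real.rpow_one ρ]
    rw [← Real.rpow_add hρ0, hρdef, ← Real.rpow_mul hn.le]
    congr 1
    ring
  have h5 : 0 < ρ ^ p := Real.rpow_pos_of_pos hρ0 _
  rw [h4, hdist, le_div_iff₀ (by positivity)]
  rw [hdist, Real.div_rpow hε.le hρ0.le] at h3
  refine le_trans (le_of_eq ?_) h3
  rw [Real.rpow_sub_one hε.ne']
  field_simp

/-- Once the base is at least 1, a larger exponent gives a larger value. It is used to pass from `(d
+ 2 * p)⁻¹` to `d⁻¹`. -/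
theorem tendsto_rpow_mul_of_le {V α β : ℝ} (hV : 0 < V) (hαβ : α ≤ β) {r : ℕ → ℝ}
    (hr : ∀ n, 0 ≤ r n)
    (h : Tendsto (fun n : ℕ => ((n : ℝ) * V) ^ α * r n) atTop atTop) :
    Tendsto (fun n : ℕ => ((n : ℝ) * V) ^ β * r n) atTop atTop := by
  have hlam : Tendsto (fun n : ℕ => (n : ℝ) * V) atTop atTop :=
    tendsto_natCast_atTop_atTop.atTop_mul_const hV
  refine tendsto_atTop_mono' _ ?_ h
  filter_upwards [hlam.eventually_ge_atTop 1] with n hn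
  exact mul_le_mul_of_nonneg_right (Real.rpow_le_rpow_of_exponent_le hn hαβ) (hr n)

end MainTheorem

theorem mainTheorem6 (d : ℕ) (hd : 1 < d) (p : ℝ) (hp : 1 < p) :
    ∃ C : ℝ, 0 < C ∧
      -- `C` is the constant of the homogeneous Poisson process of unit intensity
      (∀ (Ω : Type*) [MeasurableSpace Ω] (P : Measure Ω) [IsProbabilityMeasure P]
        (H : Ω → Set (EuclideanSpace ℝ (Fin d))) (e : EuclideanSpace ℝ (Fin d)),
        IsPoissonProcess 1 H P → ‖e‖ = 1 →
          (∀ t : ℝ, Integrable (fun ω => shortestPath p (H ω) 0 (t • e)) P) ∧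
          Tendsto (fun t : ℝ => (1 / t) * ∫ ω, shortestPath p (H ω) 0 (t • e) ∂P)
            atTop (𝓝 C)) ∧
      -- mean convergence for uniform i.i.d. samples
      (∀ (Ω : Type*) [MeasurableSpace Ω] (P : Measure Ω) [IsProbabilityMeasure P]
        (z : EuclideanSpace ℝ (Fin d)) (R₁ R₂ : ℝ) (X : ℕ → Ω → EuclideanSpace ℝ (Fin d))
        (x y : ℕ → EuclideanSpace ℝ (Fin d)),
        0 < R₁ → R₁ < R₂ →
        iIndepFun X P →
        (∀ i, HasLaw (X i)
          (volume.withDensity fun u => ENNReal.ofReal (uniformDensity z R₂ u)) P) →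
        (∀ n, x n ∈ Metric.ball z R₁) → (∀ n, y n ∈ Metric.ball z R₁) →
        Tendsto (fun n : ℕ =>
            ((n : ℝ) * uniformDensity z R₂ z) ^ (((d : ℝ) + 2 * p)⁻¹) * ‖x n - y n‖)
          atTop atTop →
          (∀ n : ℕ, Integrable
            (fun ω => shortestPath p ((fun i => X i ω) '' Set.Iio n) (x n) (y n)) P) ∧
          Tendsto (fun n : ℕ =>
              (∫ ω, shortestPath p ((fun i => X i ω) '' Set.Iio n) (x n) (y n) ∂P) /
                (((n : ℝ) * uniformDensity z R₂ z) ^ ((1 - p) / (d : ℝ)) * ‖x n - y n‖))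
            atTop (𝓝 C)) := by
  have hd' : d ≠ 0 := by omega
  have hp0 : 0 < p := by linarith
  have hd0 : (0 : ℝ) < d := by exact_mod_cast Nat.pos_of_ne_zero hd'
  have hv : ‖EuclideanSpace.single (⟨0, by omega⟩ : Fin d) (1 : ℝ)‖ = 1 := by simp
  -- Any unit vector defines the constant, by rotation invariance; only its norm is kept.
  generalize EuclideanSpace.single (⟨0, by omega⟩ : Fin d) (1 : ℝ) = v at hv
  obtain ⟨C, hC, hlim⟩ := exists_tendsto_radialMean_div hd' hp hv
  refine ⟨C, pos_of_tendsto_radialMean_div hd' hp hv hC hlim, ?_, ?_⟩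
  · intro Ω _ P _ H e hH he
    refine ⟨fun t => (integral_shortestPath_isPoissonProcess hp0 hH e t).1, hlim.congr' ?_⟩
    filter_upwards [eventually_ge_atTop 0] with t ht
    rw [(integral_shortestPath_isPoissonProcess hp0 hH e t).2, radialMean_eq hp0 hv he ht,
      one_div, inv_mul_eq_div]
  · intro Ω _ P _ z R₁ R₂ X x y hR₁ hR hX hlaw hx hy hxy
    have hR₂ : 0 < R₂ := hR₁.trans hR
    rw [withDensity_uniformDensity z hR₂] at hlaw
    have himage : ∀ (n : ℕ) (ω : Ω), (fun i => X i ω) '' Set.Iio n =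
        Set.range fun i : Fin n => X i ω := fun n ω => by
      ext w
      constructor
      · rintro ⟨i, hi, rfl⟩
        exact ⟨⟨i, hi⟩, rfl⟩
      · rintro ⟨i, rfl⟩
        exact ⟨i, i.2, rfl⟩
    have hmean := fun n : ℕ => integral_shortestPath_of_iIndepFun hp0 hX hlaw
      (g := fun i : Fin n => (i : ℕ)) Fin.val_injective (x n) (y n)
    have hdens : uniformDensity z R₂ z = (volume.real (Metric.ball z R₂))⁻¹ :=
      Set.indicator_of_mem (Metric.mem_ball_self hR₂) _
    simp only [himage, hdens, ← dist_eq_norm] at hxy ⊢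
    refine ⟨fun n => (hmean n).1, ?_⟩
    simp only [(hmean _).2]
    refine tendsto_sampleMean_div hd' hp hv hC hlim hR₁ hR hx hy rfl
      (tendsto_rpow_mul_of_le (inv_pos.2 (measureReal_ball_pos z hR₂)) ?_
        (fun n => dist_nonneg) hxy)
    exact inv_anti₀ hd0 (by linarith)
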